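/- **Theorem 2 (Convergence of DP-Clipped-SGD for non-convex objectives).** Let $d,K\ge 0$ be integers, $\beta\in(0,1]$, $\alpha\in(1,2]$, $L,\sigma,\lambda>0$, $\sigma_\omega\ge 0$, let $f:\mathbb R^d\to\mathbb R$, $x^0\in\mathbb R^d$, and let $\Delta\ge f(x^0)-f^\ast$. Put $$Q=\Big\{x\in\mathbb R^d \;\Big|\; \exists y\in\mathbb R^d:\ f(y)\le f^\ast+2\Delta,\ \|x-y\|\le \tfrac{\sqrt\Delta}{20\sqrt L}\Big\}$$ and assume: (i) $f^\ast$ is a real number and $f^\ast=\inf_{x\in Q}f(x)$; (ii) $f$ is differentiable at every point of $Q$ and $\|\nabla f(x)-\nabla f(y)\|\le L\|x-y\|$ for all $x,y\in Q$; (iii) for a random sample $\xi\sim\mathcal D$, the stochastic gradient $\nabla f_\xi(x)$ (any jointly measurable $\mathbb R^d$-valued function of $(x,\xi)$) satisfies, for all $x\in Q$, $\mathbb E_\xi[\nabla f_\xi(x)]=\nabla f(x)$ and $\mathbb E_\xi\big[\|\nabla f_\xi(x)-\nabla f(x)\|^\alpha\big]\le\sigma^\alpha$. DP-Clipped-SGD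 with step size $\gamma$ and clipping level $\lambda$ produces, for $k=0,1,\dots,K$, $$x^{k+1}=x^k-\gamma\big(\mathrm{clip}(\nabla f_{\xi^k}(x^k),\lambda)+\omega_k\big),\qquad \mathrm{clip}(v,\lambda)=\min\{1,\lambda/\|v\|\}\,v,\quad \mathrm{clip}(0,\lambda)=0,$$ where $\xi^k\sim\mathcal D$ and $\omega_k\sim\mathcal N(0,\sigma_\omega^2 I_d)$, $k\ge 0$, are all mutually independent. Let $\zeta_\lambda=\max\{0,2\sqrt{L\Delta}-\lambda/2\}$, $\phi=\sqrt{3\ln\frac{4(K+1)}{\beta}}$, and let $0<\gamma\le\min\{\frac1{4L},\gamma_1,\dots,\gamma_6\}$, where $$\gamma_1=\frac{\sqrt\Delta}{21\sqrt L\,(2^{2\alpha-1}+1)^{1/2}\sigma^{\alpha/2}\lambda^{1-\alpha/2}\sqrt{6(K+1)\ln\frac{8(K+1)}{\beta}\big(1+\frac{\zeta_\lambda^\alpha}{\sigma^\alpha}\big)}},$$ $$\gamma_2=\frac{\sqrt\Delta\,\lambda^{\alpha-1}}{14\sqrt L(K+1)2^{2\alpha-1}(\sigma^\alpha+\zeta_\lambda^\alpha)\Big(\frac{\zeta_\lambda}{\lambda}+\frac12+\frac{\lambda^{\alpha-1}\zeta_\lambda}{2^{2\alpha-1}(\sigma^\alpha+\zeta_\lambda^\alpha)}+\big(1+\frac{\zeta_\lambda^\alpha}{\sigma^\alpha}\big)^{-1/\alpha}\Big)},$$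 $$\gamma_3=\frac{\sqrt\Delta}{14\sqrt L\,\sigma_\omega\sqrt{d(K+1)}\,(\sqrt2+\sqrt2\,\phi)},\qquad \gamma_4=\frac{\sqrt\Delta}{20\sqrt L\Big(\lambda+\sigma_\omega\big(\sqrt d+\sqrt{2\ln\frac{K+1}{\beta}}\big)\Big)},$$ $$\gamma_5=\frac{\sqrt\Delta}{28\lambda\sqrt L\ln\frac{8(K+1)}{\beta}},\qquad \gamma_6=\frac{\sqrt\Delta}{\sqrt L\,\sigma_\omega\sqrt{7\Big((K+1)d+2\sqrt{(K+1)d\ln\frac{4(K+1)}{\beta}}+2\ln\frac{4(K+1)}{\beta}\Big)}}$$ (a bound whose denominator is $0$, which happens for $\gamma_3$ if $\sigma_\omega=0$ or $d=0$ and for $\gamma_6$ if $\sigma_\omega=0$, is read as $+\infty$). Then, with probability at least $1-\beta$, $f$ is differentiable at $x^0,\dots,x^K$ and $$\min_{0\le t\le K}\|\nabla f(x^t)\|^2\le\frac{8\Delta}{\gamma(K+1)}+\frac{128\Delta^2}{\lambda^2\gamma^2(K+1)^2}.$$ -/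

import Mathlib

open MeasureTheory ProbabilityTheory

noncomputable section

/-- The parameter space `ℝ^d` with its Euclidean norm. -/
abbrev Params (d : ℕ) : Type := EuclideanSpace ℝ (Fin d)

/-- The clipping operator `clip(v, c) = min {1, c / ‖v‖} v` (it sends `0` to `0`). -/
def clip {d : ℕ} (v : Params d) (c : ℝ) : Params d :=
  min 1 (c / ‖v‖) • v

/-- The law `N(0, σω² I_d)` of the injected noise. -/
def dpNoise (d : ℕ) (σω : ℝ) : Measure (Params d) :=
  multivariateGaussian 0 (σω ^ 2 • (1 : Matrix (Fin d) (Fin d) ℝ))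

/-- The iterates `x^0, x^1, …` of DP-Clipped-SGD along one realization `s` of the data samples and
`w` of the injected noise:
`x^{k+1} = x^k - γ (clip(g(x^k, s_k), lam) + w_k)`, where `g x s` is the stochastic gradient at `x`
computed from the sample `s`. -/
def dpClippedSGD {d : ℕ} {Ξ : Type*} (g : Params d → Ξ → Params d) (x₀ : Params d) (γ lam : ℝ)
    (s : ℕ → Ξ) (w : ℕ → Params d) : ℕ → Params d
  | 0 => x₀
  | k + 1 =>
    dpClippedSGD g x₀ γ lam s w k -
      γ • (clip (g (dpClippedSGD g x₀ γ lam s w k) (s k)) lam + w k)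

/-- The closed neighbourhood of radius `√Δ / (20 √L)` of the sublevel set
`{y | f y ≤ fstar + 2 Δ}`. -/
def sublevelNhd {d : ℕ} (f : Params d → ℝ) (fstar Δ L : ℝ) : Set (Params d) :=
  {x | ∃ y, f y ≤ fstar + 2 * Δ ∧ ‖x - y‖ ≤ √Δ / (20 * √L)}

/-- Lower boundedness on `Q`, with `fstar` the infimum of `f` over `Q`: a real `fstar` with
`fstar = inf_{x ∈ Q} f x`. -/
def HasInfOn {d : ℕ} (f : Params d → ℝ) (Q : Set (Params d)) (fstar : ℝ) : Prop :=
  IsGLB (f '' Q) fstar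

/-- `L`-smoothness on `Q`: `f` is differentiable at the points of `Q` and its gradient is
`L`-Lipschitz on `Q`. -/
def SmoothOn {d : ℕ} (f : Params d → ℝ) (Q : Set (Params d)) (L : ℝ) : Prop :=
  (∀ x ∈ Q, DifferentiableAt ℝ f x) ∧
    ∀ x ∈ Q, ∀ y ∈ Q, ‖gradient f x - gradient f y‖ ≤ L * ‖x - y‖

/-- The oracle `g` is unbiased on `Q` and its central `α`-th moment is at most `σ ^ α` there. -/
def OracleOn {d : ℕ} {Ξ : Type*} [MeasurableSpace Ξ] (f : Params d → ℝ) (Q : Set (Params d))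
    (g : Params d → Ξ → Params d) (D : Measure Ξ) (σ α : ℝ) : Prop :=
  ∀ x ∈ Q,
    (Integrable (g x) D ∧ ∫ s, g x s ∂D = gradient f x) ∧
    (Integrable (fun s => ‖g x s - gradient f x‖ ^ α) D ∧
      ∫ s, ‖g x s - gradient f x‖ ^ α ∂D ≤ σ ^ α)

/-- `ζ_lam = max {0, 2 √(L Δ) - lam / 2}`. -/
def zetaClip (L Δ lam : ℝ) : ℝ :=
  max 0 (2 * √(L * Δ) - lam / 2)

/-- First step-size bound. -/
def gamma₁ (K : ℕ) (L Δ lam σ α β : ℝ) : ℝ :=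
  √Δ / (21 * √L * (2 ^ (2 * α - 1) + 1) ^ ((1 : ℝ) / 2) * σ ^ (α / 2) * lam ^ (1 - α / 2) *
    √(6 * ((K : ℝ) + 1) * Real.log (8 * ((K : ℝ) + 1) / β) *
      (1 + zetaClip L Δ lam ^ α / σ ^ α)))

/-- Second step-size bound. -/
def gamma₂ (K : ℕ) (L Δ lam σ α : ℝ) : ℝ :=
  √Δ * lam ^ (α - 1) /
    (14 * √L * ((K : ℝ) + 1) * 2 ^ (2 * α - 1) * (σ ^ α + zetaClip L Δ lam ^ α) *
      (zetaClip L Δ lam / lam + 1 / 2 +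
        lam ^ (α - 1) * zetaClip L Δ lam /
          (2 ^ (2 * α - 1) * (σ ^ α + zetaClip L Δ lam ^ α)) +
        (1 + zetaClip L Δ lam ^ α / σ ^ α) ^ (-1 / α)))

/-- The quantity `φ = √(3 ln (4 (K + 1) / β))`. -/
def phiConf (K : ℕ) (β : ℝ) : ℝ :=
  √(3 * Real.log (4 * ((K : ℝ) + 1) / β))

/-- Third step-size bound (meant for `σω ≠ 0` and `d ≠ 0`). -/
def gamma₃ (d K : ℕ) (L Δ σω β : ℝ) : ℝ :=
  √Δ / (14 * √L * σω * √((d : ℝ) * ((K : ℝ) + 1)) * (√2 + √2 * phiConf K β))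

/-- Fourth step-size bound. -/
def gamma₄ (d K : ℕ) (L Δ lam σω β : ℝ) : ℝ :=
  √Δ / (20 * √L * (lam + σω * (√(d : ℝ) + √(2 * Real.log (((K : ℝ) + 1) / β)))))

/-- Fifth step-size bound. -/
def gamma₅ (K : ℕ) (L Δ lam β : ℝ) : ℝ :=
  √Δ / (28 * lam * √L * Real.log (8 * ((K : ℝ) + 1) / β))

/-- Sixth step-size bound (meant for `σω ≠ 0`). -/
def gamma₆ (d K : ℕ) (L Δ σω β : ℝ) : ℝ :=
  √Δ / (√L * σω *
    √(7 * (((K : ℝ) + 1) * d + 2 * √(((K : ℝ) + 1) * d * Real.log (4 * ((K : ℝ) + 1) / β)) +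
      2 * Real.log (4 * ((K : ℝ) + 1) / β))))

/-- The step-size condition `0 < γ ≤ min {1 / (4 L), γ₁, γ₂, γ₃, γ₄, γ₅, γ₆}`, where a bound whose
denominator vanishes (`γ₃` if `σω = 0` or `d = 0`, `γ₆` if `σω = 0`) is read as `+∞`. -/
structure StepSizeOK (d K : ℕ) (L Δ lam σ α σω β γ : ℝ) : Prop where
  pos : 0 < γ
  le_smooth : γ ≤ 1 / (4 * L)
  le₁ : γ ≤ gamma₁ K L Δ lam σ α β
  le₂ : γ ≤ gamma₂ K L Δ lam σ α
  le₃ : σω ≠ 0 → d ≠ 0 → γ ≤ gamma₃ d K L Δ σω β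
  le₄ : γ ≤ gamma₄ d K L Δ lam σω β
  le₅ : γ ≤ gamma₅ K L Δ lam β
  le₆ : σω ≠ 0 → γ ≤ gamma₆ d K L Δ σω β

/-- The algorithm's randomness: at every iteration `t` a pair `(ξ t, w t)` with law
`D ⊗ N(0, σω² I_d)` (a fresh data sample and an independent noise vector), the pairs of different
iterations being independent. -/
structure IsDPSampling {d : ℕ} {Ω Ξ : Type*} [MeasurableSpace Ω] [MeasurableSpace Ξ]
    (P : Measure Ω) (D : Measure Ξ) (σω : ℝ) (ξ : ℕ → Ω → Ξ) (w : ℕ → Ω → Params d) : Prop where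
  measurable_sample : ∀ t, Measurable (ξ t)
  measurable_noise : ∀ t, Measurable (w t)
  law : ∀ t, P.map (fun a => (ξ t a, w t a)) = D.prod (dpNoise d σω)
  indep : iIndepFun (fun t a => (ξ t a, w t a)) P

end

open scoped RealInnerProductSpace

/-! The argument is pathwise descent plus a tail bound for one stopped sum. Write `u = ∇f(x)` and
compare the clipped stochastic gradient with `clip u (lam/2)`, whose inner product with `u` is `‖u‖
min(‖u‖, lam/2)`; call the difference `e`. While `f x ≤ fstar + 2Δ` and the step is shorter than the
radius of the neighbourhood, smoothness gives `f(x⁺) ≤ f(x) - (γ/2) ‖u‖ min(‖u‖, lam/2) + Y`, where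
`Y` (`stepNoise`) gathers the linear and quadratic terms in `e` and in the Gaussian noise
(`SmoothOn.clipped_step_le`). If the partial sums of `Y` stay at most `Δ`, the trajectory cannot
leave the sublevel set, and the gradient terms sum to at most `2Δ` (`stopped_descent`,
`inf'_sq_le_of_sum_mul_min_le`).

The sum of the `Y` is controlled through its exponential moment. On the sublevel set `‖u‖ ≤ 2√(LΔ)`,
so the `α`-th moment assumption bounds the bias and second moment of the bounded error `e`, and a
Bernstein-type estimate applies; the Gaussian factor is explicit. With `ℓ = ln(8(K+1)/β)`, the
step-size bounds are what is needed for `E exp((2ℓ/Δ) Y) ≤ exp(ℓ/(K+1))` (`exponent_budget`,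
`lintegral_exp_stepNoise_le`).

Since this estimate holds only in the sublevel set, the sum is frozen on exit from it or on
exceeding `Δ`. Independence and Markov's inequality bound the probability that the frozen sum ends
above `Δ` by `exp(ℓ - 2ℓ) = β/(8(K+1))`. Excluding `K` large noise vectors, at `β/(K+1)` each,
leaves total failure probability at most `β`. -/

/-! ### Gaussian noise: exponential moments and norm tail. -/

lemma gaussianReal_exp_quadratic {a : ℝ} (ha : 2 * a < 1) (b : ℝ) :
    Integrable (fun z : ℝ => Real.exp (b * z + a * z ^ 2)) (gaussianReal 0 1) ∧
      ∫ z, Real.exp (b * z + a * z ^ 2) ∂(gaussianReal 0 1) =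
        (√(1 - 2 * a))⁻¹ * Real.exp (b ^ 2 / (2 * (1 - 2 * a))) := by
  set c : ℝ := (1 - 2 * a) / 2 with hc
  have hc0 : 0 < c := by rw [hc]; linarith
  have hpt : ∀ z : ℝ, gaussianPDFReal 0 1 z * Real.exp (b * z + a * z ^ 2) =
      (√(2 * Real.pi))⁻¹ * Real.exp (b ^ 2 / (4 * c)) *
        Real.exp (-c * (z - b / (2 * c)) ^ 2) := by
    intro z
    rw [gaussianPDFReal_def]
    simp only [NNReal.coe_one, mul_one, sub_zero]
    rw [mul_assoc, mul_assoc, ← Real.exp_add, ← Real.exp_add]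
    congr 2
    have ha' : a = 1 / 2 - c := by rw [hc]; ring
    rw [ha']
    field_simp
    ring
  have hint : Integrable (fun z : ℝ => Real.exp (-c * (z - b / (2 * c)) ^ 2)) :=
    (integrable_exp_neg_mul_sq hc0).comp_sub_right (b / (2 * c))
  refine ⟨?_, ?_⟩
  · rw [gaussianReal_of_var_ne_zero 0 one_ne_zero,
      integrable_withDensity_iff_integrable_smul' (measurable_gaussianPDF 0 1)
        (ae_of_all _ fun _ => gaussianPDF_lt_top)]
    simp only [toReal_gaussianPDF, smul_eq_mul, hpt]
    exact hint.const_mul _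
  · rw [integral_gaussianReal_eq_integral_smul one_ne_zero]
    simp only [smul_eq_mul, hpt]
    rw [integral_const_mul, integral_sub_right_eq_self (fun z : ℝ => Real.exp (-c * z ^ 2)),
      integral_gaussian]
    have h1 : (√(2 * Real.pi))⁻¹ * √(Real.pi / c) = (√(1 - 2 * a))⁻¹ := by
      have : (1 - 2 * a) = 2 * c := by rw [hc]; ring
      rw [this, ← Real.sqrt_inv, ← Real.sqrt_inv, ← Real.sqrt_mul (by positivity)]
      congr 1
      field_simp
    have h2 : b ^ 2 / (4 * c) = b ^ 2 / (2 * (1 - 2 * a)) := by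
      rw [hc]; congr 1; ring
    rw [← h1, ← h2]; ring

-- Reduces every Gaussian computation to independent standard coordinates, the degenerate case `σω =
-- 0` included.
open scoped MatrixOrder in
lemma dpNoise_eq_map_pi (d : ℕ) {σω : ℝ} (hσω : 0 ≤ σω) :
    dpNoise d σω = (Measure.pi fun _ : Fin d => gaussianReal 0 1).map
      (fun z => σω • (WithLp.toLp 2 z : Params d)) := by
  have hsqrt : CFC.sqrt (σω ^ 2 • (1 : Matrix (Fin d) (Fin d) ℝ)) =
      σω • (1 : Matrix (Fin d) (Fin d) ℝ) := by
    apply CFC.sqrt_unique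
    · rw [smul_mul_smul_comm, mul_one, sq]
    · exact smul_nonneg hσω zero_le_one
  rw [dpNoise, multivariateGaussian, ← map_pi_eq_stdGaussian, Measure.map_map (by fun_prop)
    (by fun_prop), hsqrt]
  congr 1
  ext z
  simp

lemma dpNoise_eq_map_smul (d : ℕ) {σω : ℝ} (hσω : 0 ≤ σω) :
    dpNoise d σω = (dpNoise d 1).map (fun z => σω • z) := by
  rw [dpNoise_eq_map_pi d hσω, dpNoise_eq_map_pi d zero_le_one,
    Measure.map_map (by fun_prop) (by fun_prop)]
  congr 1
  ext z
  simp

instance isProbabilityMeasure_dpNoise (d : ℕ) (σω : ℝ) : IsProbabilityMeasure (dpNoise d σω) := by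
  unfold dpNoise; infer_instance

lemma lintegral_dpNoise_one_exp {d : ℕ} (u : Params d) {a : ℝ} (ha : 2 * a < 1) :
    ∫⁻ z, ENNReal.ofReal (Real.exp (⟪u, z⟫ + a * ‖z‖ ^ 2)) ∂(dpNoise d 1) =
      ENNReal.ofReal ((√(1 - 2 * a))⁻¹ ^ d * Real.exp (‖u‖ ^ 2 / (2 * (1 - 2 * a)))) := by
  rw [dpNoise_eq_map_pi d zero_le_one, lintegral_map (by fun_prop) (by fun_prop)]
  have hpt : ∀ z : Fin d → ℝ, Real.exp (⟪u, (1 : ℝ) • (WithLp.toLp 2 z : Params d)⟫ +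
      a * ‖(1 : ℝ) • (WithLp.toLp 2 z : Params d)‖ ^ 2) =
      ∏ i, Real.exp (u i * z i + a * z i ^ 2) := by
    intro z
    rw [← Real.exp_sum, one_smul, EuclideanSpace.real_norm_sq_eq, PiLp.inner_apply,
      Finset.sum_add_distrib, Finset.mul_sum]
    simp [mul_comm]
  simp only [hpt]
  rw [← ofReal_integral_eq_lintegral_ofReal, integral_fintype_prod_eq_prod
    (f := fun i x => Real.exp (u i * x + a * x ^ 2))]
  · simp only [(gaussianReal_exp_quadratic ha _).2]
    rw [Finset.prod_mul_distrib, ← Real.exp_sum, Finset.prod_const, Finset.card_univ,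
      Fintype.card_fin, ← Finset.sum_div, EuclideanSpace.real_norm_sq_eq]
  · exact Integrable.fintype_prod (f := fun i x => Real.exp (u i * x + a * x ^ 2))
      fun i => (gaussianReal_exp_quadratic ha _).1
  · exact ae_of_all _ fun z => Finset.prod_nonneg fun i _ => (Real.exp_pos _).le

lemma lintegral_dpNoise_exp {d : ℕ} {σω : ℝ} (hσω : 0 ≤ σω) (u : Params d) {a : ℝ}
    (ha : 2 * (a * σω ^ 2) < 1) :
    ∫⁻ z, ENNReal.ofReal (Real.exp (⟪u, z⟫ + a * ‖z‖ ^ 2)) ∂(dpNoise d σω) =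
      ENNReal.ofReal ((√(1 - 2 * (a * σω ^ 2)))⁻¹ ^ d *
        Real.exp (σω ^ 2 * ‖u‖ ^ 2 / (2 * (1 - 2 * (a * σω ^ 2))))) := by
  rw [dpNoise_eq_map_smul d hσω, lintegral_map (by fun_prop) (by fun_prop)]
  have := lintegral_dpNoise_one_exp (σω • u) ha
  rw [norm_smul, mul_pow, Real.norm_eq_abs, sq_abs] at this
  rw [← this]
  refine lintegral_congr fun z => ?_
  rw [norm_smul, mul_pow, Real.norm_eq_abs, sq_abs, real_inner_smul_left, real_inner_smul_right]
  ring_nf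

/-- Chernoff bound for `‖z‖ ^ 2`, with the exponential moment of `lintegral_dpNoise_one_exp` at `u =
0`. -/
lemma dpNoise_norm_tail (d : ℕ) {σω : ℝ} (hσω : 0 ≤ σω) {x : ℝ} (hx : 0 ≤ x) :
    dpNoise d σω {z | σω * (√(d : ℝ) + √(2 * x)) < ‖z‖} ≤ ENNReal.ofReal (Real.exp (-x)) := by
  set R : ℝ := √(d : ℝ) + √(2 * x) with hR
  have hR0 : 0 ≤ R := by positivity
  rw [dpNoise_eq_map_smul d hσω, Measure.map_apply (by fun_prop)
    (measurableSet_lt (by fun_prop) (by fun_prop))]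
  refine (measure_mono (t := {z | R ≤ ‖z‖}) ?_).trans ?_
  · intro z hz
    simp only [Set.preimage_ofPred_eq, Set.mem_ofPred_eq, norm_smul, Real.norm_eq_abs,
      abs_of_nonneg hσω] at hz ⊢
    exact (lt_of_mul_lt_mul_left hz hσω).le
  rcases Nat.eq_zero_or_pos d with rfl | hd
  · rcases hx.eq_or_lt with rfl | hx
    · simpa using prob_le_one
    · have : {z : Params 0 | R ≤ ‖z‖} = ∅ := by
        ext z
        have hz : ‖z‖ = 0 := by rw [Subsingleton.elim z 0, norm_zero]
        have : 0 < R := by rw [hR]; positivity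
        simp [hz, this]
      simp [this]
  have hd' : (0 : ℝ) < d := by exact_mod_cast hd
  -- With this `s` the threshold is `R = √d (1 + s)`, and `a` is chosen so that the moment is `(1 +
  -- s) ^ d ≤ exp(d s)`, while `a R² = d s + d s² / 2 = d s + x`. The quotient is at most `exp(-x)`.
  -- Division by `√d` is why `d = 0` is treated apart.
  set s : ℝ := √(2 * x) / √(d : ℝ) with hs
  have hs0 : 0 ≤ s := by positivity
  set a : ℝ := (1 - ((1 + s) ^ 2)⁻¹) / 2 with ha
  have h12 : 1 - 2 * a = ((1 + s) ^ 2)⁻¹ := by rw [ha]; ring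
  have ha1 : 2 * a < 1 := by
    have : 0 < 1 - 2 * a := by rw [h12]; positivity
    linarith
  have ha0 : 0 ≤ a := by
    have : ((1 + s) ^ 2)⁻¹ ≤ 1 := inv_le_one_of_one_le₀ (by nlinarith)
    rw [ha]; linarith
  have hRs : R = √(d : ℝ) * (1 + s) := by rw [hR, hs]; field_simp
  have hR2 : R ^ 2 = d * (1 + s) ^ 2 := by rw [hRs, mul_pow, Real.sq_sqrt hd'.le]
  have hds : d * s ^ 2 = 2 * x := by
    rw [hs, div_pow, Real.sq_sqrt hd'.le, Real.sq_sqrt (by positivity)]; field_simp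
  have hmk := meas_ge_le_lintegral_div (μ := dpNoise d 1)
    (f := fun z => ENNReal.ofReal (Real.exp (inner ℝ 0 z + a * ‖z‖ ^ 2)))
    (by fun_prop) (ε := ENNReal.ofReal (Real.exp (a * R ^ 2)))
    (by simp [Real.exp_pos]) ENNReal.ofReal_ne_top
  rw [lintegral_dpNoise_one_exp 0 ha1, ← ENNReal.ofReal_div_of_pos (Real.exp_pos _)] at hmk
  refine (measure_mono ?_).trans (hmk.trans (ENNReal.ofReal_le_ofReal ?_))
  · intro z hz
    simp only [Set.mem_ofPred_eq, inner_zero_left, zero_add] at hz ⊢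
    gcongr
  · rw [h12, Real.sqrt_inv, inv_inv, Real.sqrt_sq (by positivity), norm_zero]
    simp only [ne_eq, OfNat.ofNat_ne_zero, not_false_eq_true, zero_pow, zero_div, Real.exp_zero,
      mul_one]
    rw [div_le_iff₀ (Real.exp_pos _), ← Real.exp_add]
    calc (1 + s) ^ d ≤ Real.exp s ^ d := by
          gcongr; linarith [Real.add_one_le_exp s]
      _ = Real.exp (d * s) := by rw [← Real.exp_nat_mul]
      _ ≤ _ := by
          apply Real.exp_le_exp.2
          have : a * R ^ 2 = d * ((1 + s) ^ 2 - 1) / 2 := by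
            rw [hR2, ha]; field_simp
          rw [this]
          nlinarith

/-! ### Smoothness near the sublevel set. -/

lemma SmoothOn.le_quadratic {d : ℕ} {f : Params d → ℝ} {Q : Set (Params d)} {L : ℝ}
    (hf : SmoothOn f Q L) {x y : Params d} (hseg : segment ℝ x y ⊆ Q) :
    f y ≤ f x + ⟪gradient f x, y - x⟫ + L / 2 * ‖y - x‖ ^ 2 := by
  set h := y - x with hh
  have hmem : ∀ t ∈ Set.Icc (0 : ℝ) 1, x + t • h ∈ Q := fun t ht =>
    hseg (by rw [segment_eq_image']; exact ⟨t, ht, rfl⟩)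
  have hx : x ∈ Q := hseg (left_mem_segment ℝ x y)
  have hder : ∀ t ∈ Set.Icc (0 : ℝ) 1,
      HasDerivAt (fun t : ℝ => f (x + t • h) - t * ⟪gradient f x, h⟫ - L / 2 * t ^ 2 * ‖h‖ ^ 2)
        (⟪gradient f (x + t • h), h⟫ - ⟪gradient f x, h⟫ - L * t * ‖h‖ ^ 2) t := by
    intro t ht
    have h1 : HasDerivAt (fun t : ℝ => x + t • h) h t := by
      simpa using ((hasDerivAt_id t).smul_const h).const_add x
    have h2 := ((hf.1 _ (hmem t ht)).hasGradientAt.hasFDerivAt.comp_hasDerivAt t h1)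
    have h3 : HasDerivAt (fun t : ℝ => t * ⟪gradient f x, h⟫) ⟪gradient f x, h⟫ t := by
      simpa using (hasDerivAt_id t).mul_const ⟪gradient f x, h⟫
    have h4 : HasDerivAt (fun t : ℝ => L / 2 * t ^ 2 * ‖h‖ ^ 2) (L * t * ‖h‖ ^ 2) t := by
      have := ((hasDerivAt_pow 2 t).const_mul (L / 2)).mul_const (‖h‖ ^ 2)
      refine this.congr_deriv ?_
      push_cast; ring
    exact (h2.sub h3).sub h4
  have hanti : AntitoneOn
      (fun t : ℝ => f (x + t • h) - t * ⟪gradient f x, h⟫ - L / 2 * t ^ 2 * ‖h‖ ^ 2)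
      (Set.Icc 0 1) := by
    refine antitoneOn_of_deriv_nonpos (convex_Icc 0 1)
      (fun t ht => (hder t ht).continuousAt.continuousWithinAt)
      (fun t ht => (hder t (interior_subset ht)).differentiableAt.differentiableWithinAt) ?_
    intro t ht
    have ht := interior_subset ht
    rw [(hder t ht).deriv, ← inner_sub_left]
    have h1 := real_inner_le_norm (gradient f (x + t • h) - gradient f x) h
    have h2 := hf.2 _ (hmem t ht) _ hx
    rw [add_sub_cancel_left, norm_smul, Real.norm_eq_abs, abs_of_nonneg ht.1] at h2
    nlinarith [norm_nonneg h]
  have := hanti (Set.left_mem_Icc.2 zero_le_one) (Set.right_mem_Icc.2 zero_le_one) zero_le_one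
  simp only [one_smul, zero_smul, add_zero, hh, add_sub_cancel] at this ⊢
  linarith

lemma mem_sublevelNhd {d : ℕ} {f : Params d → ℝ} {fstar Δ L : ℝ} {y : Params d}
    (hy : f y ≤ fstar + 2 * Δ) : y ∈ sublevelNhd f fstar Δ L :=
  ⟨y, hy, by simpa using by positivity⟩

lemma HasInfOn.le {d : ℕ} {f : Params d → ℝ} {fstar Δ L : ℝ} (hΔ : 0 ≤ Δ)
    (hinf : HasInfOn f (sublevelNhd f fstar Δ L) fstar) (x : Params d) : fstar ≤ f x := by
  by_cases hx : f x ≤ fstar + 2 * Δ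
  · exact hinf.1 ⟨x, mem_sublevelNhd hx, rfl⟩
  · linarith

/-- A gradient step of length `‖∇f(x)‖ / L` decreases `f` by `‖∇f(x)‖² / (2L)`, and `f` cannot fall
below `fstar`. Smoothness is known only near the sublevel set and the step may exceed the radius, so
the segment is covered in increments `δ`: each new point is close to an earlier one at which `f` has
not increased. -/
lemma sq_norm_gradient_le {d : ℕ} {f : Params d → ℝ} {fstar Δ L : ℝ} (hL : 0 < L) (hΔ : 0 < Δ)
    (hinf : HasInfOn f (sublevelNhd f fstar Δ L) fstar)
    (hf : SmoothOn f (sublevelNhd f fstar Δ L) L) {x : Params d}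
    (hx : f x ≤ fstar + 2 * Δ) : ‖gradient f x‖ ^ 2 ≤ 2 * L * (f x - fstar) := by
  set h := gradient f x with hh
  have hstep : ∀ t : ℝ, 0 ≤ t →
      (∀ s ∈ Set.Icc (0 : ℝ) t, x + s • (-h) ∈ sublevelNhd f fstar Δ L) →
      f (x + t • (-h)) ≤ f x - t * ‖h‖ ^ 2 + L / 2 * t ^ 2 * ‖h‖ ^ 2 := by
    intro t ht hs
    have := hf.le_quadratic (x := x) (y := x + t • (-h)) (by
      rw [segment_eq_image']
      rintro _ ⟨c, hc, rfl⟩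
      simp only [add_sub_cancel_left, smul_smul]
      exact hs _ ⟨mul_nonneg hc.1 ht, by nlinarith [hc.2]⟩)
    rw [add_sub_cancel_left, norm_smul, norm_neg, mul_pow, real_inner_smul_right,
      inner_neg_right, ← hh, real_inner_self_eq_norm_sq, Real.norm_eq_abs, sq_abs] at this
    linarith
  set r : ℝ := √Δ / (20 * √L) with hr
  have hr0 : 0 < r := by positivity
  obtain ⟨δ, hδ, hδr⟩ : ∃ δ > 0, δ * ‖h‖ ≤ r := by
    refine ⟨r / (‖h‖ + 1), by positivity, ?_⟩
    rw [div_mul_eq_mul_div, div_le_iff₀ (by positivity)]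
    nlinarith [norm_nonneg h]
  have hind : ∀ n : ℕ, ∀ t : ℝ, 0 ≤ t → t ≤ n * δ → t ≤ 1 / L →
      f (x + t • (-h)) ≤ fstar + 2 * Δ := by
    intro n
    induction n with
    | zero =>
      intro t ht0 ht _
      have : t = 0 := by
        simp at ht; linarith
      simpa [this] using hx
    | succ n ih =>
      intro t ht0 ht htL
      have hmem : ∀ s ∈ Set.Icc (0 : ℝ) t, x + s • (-h) ∈ sublevelNhd f fstar Δ L := by
        intro s hs
        refine ⟨x + (max 0 (s - δ)) • (-h), ih _ (le_max_left _ _) ?_ ?_, ?_⟩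
        · refine max_le (by positivity) ?_
          push_cast at ht
          linarith [hs.2]
        · exact max_le (by positivity) (by linarith [hs.2])
        · rw [add_sub_add_left_eq_sub, ← sub_smul, norm_smul, norm_neg, Real.norm_eq_abs]
          refine le_trans ?_ hδr
          gcongr
          rcases le_total 0 (s - δ) with h | h
          · rw [max_eq_right h, sub_sub_cancel, abs_of_pos hδ]
          · rw [max_eq_left h, sub_zero, abs_of_nonneg hs.1]; linarith
      have h1 := hstep t ht0 hmem
      have h2 : L * t ≤ 1 := by
        rw [le_div_iff₀ hL] at htL; linarith
      nlinarith [mul_nonneg ht0 (sq_nonneg ‖h‖)]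
  obtain ⟨n, hn⟩ := exists_nat_ge (1 / L / δ)
  have hn' : 1 / L ≤ n * δ := by rwa [div_le_iff₀ hδ] at hn
  have h1 := hstep (1 / L) (by positivity) fun s hs =>
    mem_sublevelNhd (hind n s hs.1 (hs.2.trans hn') hs.2)
  have h2 := hinf.le hΔ.le (x + (1 / L) • (-h))
  have h3 : fstar ≤ f x - ‖h‖ ^ 2 / (2 * L) := by
    refine h2.trans (h1.trans_eq ?_)
    field_simp
    ring
  have h4 : ‖h‖ ^ 2 / (2 * L) ≤ f x - fstar := by linarith
  rw [div_le_iff₀ (by positivity)] at h4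
  linarith

/-- `f` may be discontinuous elsewhere, but a limit of sublevel points lies in the neighbourhood,
where `f` is continuous. -/
lemma isClosed_sublevel {d : ℕ} {f : Params d → ℝ} {fstar Δ L : ℝ} (hL : 0 < L) (hΔ : 0 < Δ)
    (hf : SmoothOn f (sublevelNhd f fstar Δ L) L) : IsClosed {x | f x ≤ fstar + 2 * Δ} := by
  refine isClosed_of_closure_subset fun x hx => ?_
  have hr0 : 0 < √Δ / (20 * √L) := by positivity
  have hxQ : x ∈ sublevelNhd f fstar Δ L := by
    obtain ⟨y, hy, hxy⟩ := Metric.mem_closure_iff.1 hx _ hr0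
    exact ⟨y, hy, by rw [← dist_eq_norm]; exact hxy.le⟩
  have hc : ContinuousAt f x := (hf.1 x hxQ).continuousAt
  obtain ⟨y, hy, hlim⟩ := mem_closure_iff_seq_limit.1 hx
  exact le_of_tendsto' (hc.tendsto.comp hlim) hy

lemma continuousOn_gradient {d : ℕ} {f : Params d → ℝ} {Q : Set (Params d)} {L : ℝ} (hL : 0 < L)
    (hf : SmoothOn f Q L) : ContinuousOn (gradient f) Q := by
  refine (LipschitzOnWith.of_dist_le_mul (K := L.toNNReal) fun x hx y hy => ?_).continuousOn
  rw [dist_eq_norm, dist_eq_norm, Real.coe_toNNReal _ hL.le]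
  exact hf.2 x hx y hy

/-! ### The clipping operator. -/

section Clip

variable {d : ℕ}

lemma clip_of_norm_le {v : Params d} {c : ℝ} (h : ‖v‖ ≤ c) : clip v c = v := by
  rcases eq_or_ne v 0 with rfl | hv
  · simp [clip]
  · rw [clip, min_eq_left, one_smul]
    rwa [one_le_div (norm_pos_iff.2 hv)]

lemma clip_of_lt_norm {v : Params d} {c : ℝ} (hc : 0 ≤ c) (h : c < ‖v‖) :
    clip v c = (c / ‖v‖) • v := by
  rw [clip, min_eq_right]
  exact (div_le_one (hc.trans_lt h)).2 h.le

lemma norm_clip {v : Params d} {c : ℝ} (hc : 0 ≤ c) : ‖clip v c‖ = min ‖v‖ c := by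
  rcases le_or_gt ‖v‖ c with h | h
  · rw [clip_of_norm_le h, min_eq_left h]
  · have : 0 < ‖v‖ := hc.trans_lt h
    rw [clip_of_lt_norm hc h, min_eq_right h.le, norm_smul, Real.norm_eq_abs,
      abs_of_nonneg (by positivity)]
    field_simp

lemma inner_clip {v : Params d} {c : ℝ} (hc : 0 ≤ c) : ⟪v, clip v c⟫ = ‖v‖ * min ‖v‖ c := by
  rcases le_or_gt ‖v‖ c with h | h
  · rw [clip_of_norm_le h, min_eq_left h, real_inner_self_eq_norm_mul_norm]
  · have : 0 < ‖v‖ := hc.trans_lt h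
    rw [clip_of_lt_norm hc h, min_eq_right h.le, real_inner_smul_right,
      real_inner_self_eq_norm_mul_norm]
    field_simp

lemma norm_sub_clip {v : Params d} {c : ℝ} (hc : 0 ≤ c) : ‖v - clip v c‖ = max 0 (‖v‖ - c) := by
  rcases le_or_gt ‖v‖ c with h | h
  · rw [clip_of_norm_le h, max_eq_left (by linarith)]; simp
  · have hv : 0 < ‖v‖ := hc.trans_lt h
    have : v - clip v c = (1 - c / ‖v‖) • v := by
      rw [clip_of_lt_norm hc h, sub_smul, one_smul]
    rw [this, max_eq_right (by linarith), norm_smul, Real.norm_eq_abs, abs_of_nonneg]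
    · field_simp
    · rw [sub_nonneg]; exact (div_le_one hv).2 h.le

lemma measurable_clip (c : ℝ) : Measurable fun v : Params d => clip v c := by
  unfold clip; fun_prop

lemma norm_clip_sub_clip_half_le {v w : Params d} {c : ℝ} (hc : 0 ≤ c) :
    ‖clip v c - clip w (c / 2)‖ ≤ 3 / 2 * c := by
  have h1 := norm_sub_le (clip v c) (clip w (c / 2))
  rw [norm_clip hc, norm_clip (by linarith)] at h1
  linarith [min_le_right ‖v‖ c, min_le_right ‖w‖ (c / 2)]

/-- The gap between the levels `c` and `c / 2` is what matters: if `v` is really clipped, it is at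
distance at least `c / 2` from `clip w (c / 2)`, so the trivial bound `3c/2` suffices. -/
lemma norm_clip_sub_clip_half_le_mul {v w : Params d} {c : ℝ} (hc : 0 ≤ c) :
    ‖clip v c - clip w (c / 2)‖ ≤ 3 * ‖v - clip w (c / 2)‖ := by
  rcases le_or_gt ‖v‖ c with h | h
  · rw [clip_of_norm_le h]; linarith [norm_nonneg (v - clip w (c / 2))]
  · have h1 := norm_sub_norm_le v (clip w (c / 2))
    have h2 : ‖clip w (c / 2)‖ ≤ c / 2 := by
      rw [norm_clip (by linarith)]; exact min_le_right _ _
    linarith [norm_clip_sub_clip_half_le (v := v) (w := w) hc]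

end Clip

/-! ### Bias, second moment and exponential moment of the clipping error. -/

lemma sub_le_rpow_mul_rpow {a y α : ℝ} (ha : 0 < a) (hy : 0 ≤ y) (hα : 1 ≤ α) :
    max 0 (y - a) ≤ y ^ α * a ^ (1 - α) := by
  rcases le_or_gt y a with h | h
  · rw [max_eq_left (by linarith)]; positivity
  · rw [max_eq_right (by linarith)]
    have hy0 : 0 < y := ha.trans h
    have h1 : y ^ α * a ^ (1 - α) = y * (y / a) ^ (α - 1) := by
      rw [Real.div_rpow hy ha.le, Real.rpow_sub_one hy0.ne', show 1 - α = -(α - 1) by ring,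
        Real.rpow_neg ha.le]
      field_simp
    rw [h1]
    have h2 : 1 ≤ (y / a) ^ (α - 1) :=
      Real.one_le_rpow ((one_le_div ha).2 h.le) (by linarith)
    nlinarith

lemma add_rpow_le_two_rpow_mul {a b α : ℝ} (ha : 0 ≤ a) (hb : 0 ≤ b) (hα : 1 ≤ α) :
    (a + b) ^ α ≤ 2 ^ (α - 1) * (a ^ α + b ^ α) := by
  lift a to NNReal using ha
  lift b to NNReal using hb
  exact_mod_cast NNReal.rpow_add_le_mul_rpow_add_rpow a b hα

section Moments

variable {d : ℕ} {Ξ : Type*} [MeasurableSpace Ξ] {D : Measure Ξ} [IsProbabilityMeasure D]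
  {g : Ξ → Params d} {u : Params d} {σ α ζ lam : ℝ}

lemma norm_sub_clip_half_le (hlam : 0 < lam) (hζ : 0 ≤ ζ) (hu : ‖u‖ ≤ lam / 2 + ζ) :
    ‖u - clip u (lam / 2)‖ ≤ ζ := by
  rw [norm_sub_clip (by linarith)]
  exact max_le hζ (by linarith)

lemma integral_rpow_norm_sub_add_le
    (hint : Integrable (fun s => ‖g s - u‖ ^ α) D) (hmom : ∫ s, ‖g s - u‖ ^ α ∂D ≤ σ ^ α) :
    ∫ s, 2 ^ (α - 1) * (‖g s - u‖ ^ α + ζ ^ α) ∂D ≤ 2 ^ (α - 1) * (σ ^ α + ζ ^ α) := by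
  rw [integral_const_mul, integral_add hint (integrable_const _)]
  simp only [integral_const, probReal_univ, one_smul]
  gcongr

/-- By unbiasedness the bias is `u - clip u (lam / 2)`, of norm at most `ζ`, minus the mean of `g -
clip g lam`. The latter is nonzero only when `‖g - u‖ + ζ > lam / 2`, a deviation paid for by the
`α`-th moment. -/
lemma norm_integral_clip_sub_le (hlam : 0 < lam) (hζ : 0 ≤ ζ) (hα : 1 ≤ α)
    (hu : ‖u‖ ≤ lam / 2 + ζ) (hg : Measurable g) (hgint : Integrable g D)
    (hgu : ∫ s, g s ∂D = u) (hint : Integrable (fun s => ‖g s - u‖ ^ α) D)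
    (hmom : ∫ s, ‖g s - u‖ ^ α ∂D ≤ σ ^ α) :
    ‖∫ s, (clip (g s) lam - clip u (lam / 2)) ∂D‖ ≤
      ζ + 2 ^ (α - 1) * (σ ^ α + ζ ^ α) * (lam / 2) ^ (1 - α) := by
  have hcint : Integrable (fun s => clip (g s) lam) D :=
    Integrable.of_bound ((measurable_clip lam).comp hg).aestronglyMeasurable lam
      (ae_of_all _ fun s => by rw [norm_clip hlam.le]; exact min_le_right _ _)
  have heq : ∫ s, (clip (g s) lam - clip u (lam / 2)) ∂D =
      (u - clip u (lam / 2)) - ∫ s, (g s - clip (g s) lam) ∂D := by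
    rw [integral_sub hcint (integrable_const _), integral_sub hgint hcint, hgu]
    simp only [integral_const, probReal_univ, one_smul]
    abel
  rw [heq]
  refine (norm_sub_le _ _).trans (add_le_add (norm_sub_clip_half_le hlam hζ hu) ?_)
  have hI : Integrable (fun s => 2 ^ (α - 1) * (‖g s - u‖ ^ α + ζ ^ α)) D :=
    (hint.add (integrable_const _)).const_mul _
  calc ‖∫ s, (g s - clip (g s) lam) ∂D‖
      ≤ ∫ s, 2 ^ (α - 1) * (‖g s - u‖ ^ α + ζ ^ α) * (lam / 2) ^ (1 - α) ∂D := by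
        refine norm_integral_le_of_norm_le (hI.mul_const _) (ae_of_all _ fun s => ?_)
        rw [norm_sub_clip hlam.le]
        have h1 : ‖g s‖ ≤ ‖g s - u‖ + ‖u‖ := by
          simpa using norm_add_le (g s - u) u
        calc max 0 (‖g s‖ - lam) ≤ max 0 ((‖g s - u‖ + ζ) - lam / 2) :=
              max_le_max le_rfl (by linarith)
          _ ≤ (‖g s - u‖ + ζ) ^ α * (lam / 2) ^ (1 - α) :=
              sub_le_rpow_mul_rpow (by linarith) (by positivity) hα
          _ ≤ _ := by
              gcongr
              exact add_rpow_le_two_rpow_mul (norm_nonneg _) hζ hα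
    _ ≤ _ := by
        rw [integral_mul_const]
        gcongr
        exact integral_rpow_norm_sub_add_le hint hmom

/-- Interpolation `n² = n ^ (2 - α) n ^ α`: the first factor uses boundedness of the error, the
second its domination by the deviation of `g`. -/
lemma integral_sq_norm_clip_sub_le (hlam : 0 < lam) (hζ : 0 ≤ ζ) (hα : 1 ≤ α) (hα2 : α ≤ 2)
    (hu : ‖u‖ ≤ lam / 2 + ζ) (hint : Integrable (fun s => ‖g s - u‖ ^ α) D)
    (hmom : ∫ s, ‖g s - u‖ ^ α ∂D ≤ σ ^ α) :
    ∫ s, ‖clip (g s) lam - clip u (lam / 2)‖ ^ 2 ∂D ≤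
      9 * lam ^ (2 - α) * (2 ^ (α - 1) * (σ ^ α + ζ ^ α)) := by
  have hI : Integrable (fun s => 2 ^ (α - 1) * (‖g s - u‖ ^ α + ζ ^ α)) D :=
    (hint.add (integrable_const _)).const_mul _
  refine (integral_mono_of_nonneg (ae_of_all _ fun s => sq_nonneg _)
    (hI.const_mul (9 * lam ^ (2 - α))) (ae_of_all _ fun s => ?_)).trans ?_
  · set n := ‖clip (g s) lam - clip u (lam / 2)‖ with hn
    have hn0 : 0 ≤ n := norm_nonneg _
    set y := ‖g s - u‖ + ζ with hy
    have hy0 : 0 ≤ y := by positivity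
    have h1 : n ≤ 3 / 2 * lam := norm_clip_sub_clip_half_le hlam.le
    have h2 : n ≤ 3 * y := by
      refine (norm_clip_sub_clip_half_le_mul hlam.le).trans ?_
      have h3 : ‖g s - clip u (lam / 2)‖ ≤ ‖g s - u‖ + ‖u - clip u (lam / 2)‖ := by
        simpa using norm_add_le (g s - u) (u - clip u (lam / 2))
      linarith [norm_sub_clip_half_le hlam hζ hu]
    calc n ^ 2 = n ^ (2 - α) * n ^ α := by
          rw [← Real.rpow_add_of_nonneg hn0 (by linarith) (by linarith)]
          norm_num
      -- The bound `3/2 * lam` is relaxed to `3 * lam` so that the powers of `3` combine to `9`.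
      _ ≤ (3 * lam) ^ (2 - α) * (3 * y) ^ α := by
          refine mul_le_mul (Real.rpow_le_rpow hn0 (by linarith) (by linarith))
            (Real.rpow_le_rpow hn0 h2 (by linarith)) (by positivity) (by positivity)
      _ = 9 * lam ^ (2 - α) * y ^ α := by
          rw [Real.mul_rpow (by norm_num) hlam.le, Real.mul_rpow (by norm_num) hy0]
          have : (3 : ℝ) ^ (2 - α) * 3 ^ α = 9 := by
            rw [← Real.rpow_add (by norm_num)]; norm_num
          linear_combination lam ^ (2 - α) * y ^ α * this
      _ ≤ _ := by
          exact mul_le_mul_of_nonneg_left (add_rpow_le_two_rpow_mul (norm_nonneg _) hζ hα)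
            (by positivity)
  · rw [integral_const_mul]
    gcongr
    exact integral_rpow_norm_sub_add_le hint hmom

/-- Bernstein-type bound from `exp y ≤ 1 + y + y²` for `|y| ≤ 1`. The quadratic term is kept in the
exponent, and boundedness of `θ` gives `|y| ≤ (‖b‖ + q M) ‖θ‖`. -/
lemma integral_exp_neg_inner_add_sq_le {θ : Ξ → Params d} {M q : ℝ} (hθ : Measurable θ)
    (hM : ∀ s, ‖θ s‖ ≤ M) (hq : 0 ≤ q) (b : Params d) (h1 : ‖b‖ * M + q * M ^ 2 ≤ 1) :
    ∫ s, Real.exp (-⟪b, θ s⟫ + q * ‖θ s‖ ^ 2) ∂D ≤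
      Real.exp (‖b‖ * ‖∫ s, θ s ∂D‖ + (q + (‖b‖ + q * M) ^ 2) * ∫ s, ‖θ s‖ ^ 2 ∂D) := by
  have hθint : Integrable θ D := Integrable.of_bound hθ.aestronglyMeasurable M (ae_of_all _ hM)
  have hθ2 : Integrable (fun s => ‖θ s‖ ^ 2) D :=
    Integrable.of_bound (by fun_prop) (M ^ 2) (ae_of_all _ fun s => by
      rw [Real.norm_eq_abs, abs_of_nonneg (sq_nonneg _)]
      gcongr
      exact hM s)
  have hbθ : Integrable (fun s => ⟪b, θ s⟫) D := hθint.const_inner b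
  have hpt : ∀ s, Real.exp (-⟪b, θ s⟫ + q * ‖θ s‖ ^ 2) ≤
      1 - ⟪b, θ s⟫ + (q + (‖b‖ + q * M) ^ 2) * ‖θ s‖ ^ 2 := by
    intro s
    set n := ‖θ s‖ with hn
    have hn0 : 0 ≤ n := norm_nonneg _
    have hnM : n ≤ M := hM s
    have hb := abs_real_inner_le_norm b (θ s)
    rw [← hn] at hb
    have habs : |-⟪b, θ s⟫ + q * n ^ 2| ≤ (‖b‖ + q * M) * n := by
      refine (abs_add_le _ _).trans ?_
      rw [abs_neg, abs_of_nonneg (by positivity : 0 ≤ q * n ^ 2)]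
      nlinarith [mul_le_mul_of_nonneg_left hnM (mul_nonneg hq hn0)]
    have hle1 : |-⟪b, θ s⟫ + q * n ^ 2| ≤ 1 := by
      refine habs.trans (le_trans ?_ h1)
      have : 0 ≤ ‖b‖ + q * M := by have := hn0.trans hnM; positivity
      nlinarith [mul_le_mul_of_nonneg_left hnM this]
    have h := (abs_le.1 (Real.abs_exp_sub_one_sub_id_le hle1)).2
    have hsq : (-⟪b, θ s⟫ + q * n ^ 2) ^ 2 ≤ ((‖b‖ + q * M) * n) ^ 2 :=
      sq_le_sq' (by linarith [(abs_le.1 habs).1]) ((le_abs_self _).trans habs)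
    rw [mul_pow] at hsq
    nlinarith
  have hint : Integrable (fun s => 1 - ⟪b, θ s⟫ + (q + (‖b‖ + q * M) ^ 2) * ‖θ s‖ ^ 2) D :=
    ((integrable_const _).sub hbθ).add (hθ2.const_mul _)
  calc ∫ s, Real.exp (-⟪b, θ s⟫ + q * ‖θ s‖ ^ 2) ∂D
      ≤ ∫ s, (1 - ⟪b, θ s⟫ + (q + (‖b‖ + q * M) ^ 2) * ‖θ s‖ ^ 2) ∂D :=
        integral_mono_of_nonneg (ae_of_all _ fun s => (Real.exp_pos _).le) hint
          (ae_of_all _ hpt)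
    _ = 1 - ⟪b, ∫ s, θ s ∂D⟫ + (q + (‖b‖ + q * M) ^ 2) * ∫ s, ‖θ s‖ ^ 2 ∂D := by
        have hi : Integrable (fun s => 1 - ⟪b, θ s⟫) D := (integrable_const _).sub hbθ
        rw [integral_add hi (hθ2.const_mul _), integral_sub (integrable_const _) hbθ,
          integral_const_mul, integral_inner hθint]
        simp
    _ ≤ _ := by
        have h2 := (abs_le.1 (abs_real_inner_le_norm b (∫ s, θ s ∂D))).1
        refine le_trans ?_ (Real.add_one_le_exp _)
        linarith

end Moments

/-! ### Exponential moments along a Markov chain. -/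

/-- The state at time `t` depends only on innovations before `t`, hence is independent of `ζ t`;
Fubini then costs one factor `c` per step. -/
lemma lintegral_markovChain_le {Ω E Z : Type*} [MeasurableSpace Ω] [MeasurableSpace E]
    [MeasurableSpace Z] {P : Measure Ω} [IsProbabilityMeasure P] {μ : Measure Z} [SFinite μ]
    {ζ : ℕ → Ω → Z} (hζ : ∀ t, Measurable (ζ t)) (hlaw : ∀ t, P.map (ζ t) = μ)
    (hind : iIndepFun ζ P) {Φ : E → Z → E} (hΦ : Measurable (Function.uncurry Φ))
    {X : ℕ → Ω → E} {x₀ : E} (hX0 : ∀ a, X 0 a = x₀)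
    (hX : ∀ t a, X (t + 1) a = Φ (X t a) (ζ t a)) {V : E → ENNReal} (hV : Measurable V)
    {c : ENNReal} (hc : ∀ x, ∫⁻ z, V (Φ x z) ∂μ ≤ c * V x) (t : ℕ) :
    ∫⁻ a, V (X t a) ∂P ≤ c ^ t * V x₀ := by
  let m : ℕ → MeasurableSpace Ω := fun i => MeasurableSpace.comap (ζ i) inferInstance
  have hm : ∀ i, m i ≤ ‹MeasurableSpace Ω› := fun i => (hζ i).comap_le
  have hmono : Monotone fun t => ⨆ i ∈ Set.Iio t, m i := fun s t hst =>
    biSup_mono fun i hi => lt_of_lt_of_le hi hst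
  have hXm : ∀ t, Measurable[⨆ i ∈ Set.Iio t, m i] (X t) := by
    intro t
    induction t with
    | zero => rw [show X 0 = fun _ => x₀ from funext hX0]; exact measurable_const
    | succ t ih =>
      rw [show X (t + 1) = fun a => Function.uncurry Φ (X t a, ζ t a) from funext (hX t)]
      refine hΦ.comp (Measurable.prodMk (ih.mono (hmono t.le_succ) le_rfl) ?_)
      exact (comap_measurable (ζ t)).mono
        (le_biSup m (show t ∈ Set.Iio (t + 1) from t.lt_succ_self)) le_rfl
  have hXm' : ∀ t, Measurable (X t) := fun t =>
    (hXm t).mono (iSup₂_le fun i _ => hm i) le_rfl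
  induction t with
  | zero => simp [hX0]
  | succ t ih =>
    have hindep : IndepFun (X t) (ζ t) P := by
      have h := indep_iSup_of_disjoint hm hind.iIndep
        (S := Set.Iio t) (T := {t}) (by simp)
      rw [IndepFun_iff_Indep]
      refine indep_of_indep_of_le_left (indep_of_indep_of_le_right h ?_) (hXm t).comap_le
      simp [m]
    have hprod := (indepFun_iff_map_prod_eq_prod_map_map (hXm' t).aemeasurable
      (hζ t).aemeasurable).1 hindep
    have hmeas : Measurable fun p : E × Z => V (Φ p.1 p.2) := hV.comp hΦ
    calc ∫⁻ a, V (X (t + 1) a) ∂P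
        = ∫⁻ a, (fun p : E × Z => V (Φ p.1 p.2)) (X t a, ζ t a) ∂P := by simp [hX]
      _ = ∫⁻ p, V (Φ p.1 p.2) ∂((P.map (X t)).prod μ) := by
          rw [← hlaw t, ← hprod, lintegral_map hmeas ((hXm' t).prodMk (hζ t))]
      _ = ∫⁻ x, ∫⁻ z, V (Φ x z) ∂μ ∂(P.map (X t)) := lintegral_prod _ hmeas.aemeasurable
      _ ≤ ∫⁻ x, c * V x ∂(P.map (X t)) := lintegral_mono hc
      _ = c * ∫⁻ a, V (X t a) ∂P := by
          rw [lintegral_const_mul _ hV, lintegral_map hV (hXm' t)]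
      _ ≤ c * (c ^ t * V x₀) := by gcongr
      _ = c ^ (t + 1) * V x₀ := by rw [pow_succ]; ring

/-! ### Consequences of the step-size bounds. -/

lemma zetaClip_nonneg (L Δ lam : ℝ) : 0 ≤ zetaClip L Δ lam := le_max_left _ _

/-- Lets all budgets be written in the single logarithm `ℓ = ln(8(K+1)/β)`, although `gamma₃` and
`gamma₆` involve `ln(4(K+1)/β)`. -/
lemma two_mul_log_four_le {K : ℕ} {β : ℝ} (hβ : 0 < β) (hβ1 : β ≤ 1) :
    2 ≤ Real.log (8 * ((K : ℝ) + 1) / β) ∧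
      2 * Real.log (8 * ((K : ℝ) + 1) / β) ≤ 3 * Real.log (4 * ((K : ℝ) + 1) / β) := by
  have hK : (0 : ℝ) ≤ K := K.cast_nonneg
  have h1 : 1 ≤ ((K : ℝ) + 1) / β := by rw [one_le_div hβ]; linarith
  have h0 := Real.log_nonneg h1
  have h2 : (0 : ℝ) < ((K : ℝ) + 1) / β := by positivity
  have e8 : Real.log (8 * ((K : ℝ) + 1) / β) =
      3 * Real.log 2 + Real.log (((K : ℝ) + 1) / β) := by
    rw [mul_div_assoc, Real.log_mul (by norm_num) h2.ne', show (8 : ℝ) = 2 ^ 3 by norm_num,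
      Real.log_pow]
    norm_num
  have e4 : Real.log (4 * ((K : ℝ) + 1) / β) =
      2 * Real.log 2 + Real.log (((K : ℝ) + 1) / β) := by
    rw [mul_div_assoc, Real.log_mul (by norm_num) h2.ne', show (4 : ℝ) = 2 ^ 2 by norm_num,
      Real.log_pow]
    norm_num
  rw [e8, e4]
  have := Real.log_two_gt_d9
  constructor <;> linarith

lemma two_rpow_two_mul_sub_one (α : ℝ) :
    (2 : ℝ) ^ (2 * α - 1) = 2 * (2 ^ (α - 1) * 2 ^ (α - 1)) := by
  have h2 : (2 : ℝ) ≠ 0 := by norm_num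
  rw [← Real.rpow_add (by norm_num), mul_comm 2 ((2 : ℝ) ^ _), ← Real.rpow_add_one h2]
  congr 1; ring

lemma gamma₁_bound {K : ℕ} {L Δ lam σ α β γ : ℝ} (hL : 0 < L) (hΔ : 0 < Δ) (hσ : 0 < σ)
    (hlam : 0 < lam) (hβ : 0 < β) (hβ1 : β ≤ 1) (hγ0 : 0 ≤ γ)
    (h : γ ≤ gamma₁ K L Δ lam σ α β) :
    588 * (γ ^ 2 * L * ((K : ℝ) + 1) * Real.log (8 * ((K : ℝ) + 1) / β)) *
      (9 * lam ^ (2 - α) * (2 ^ (α - 1) * (σ ^ α + zetaClip L Δ lam ^ α))) ≤ Δ := by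
  obtain ⟨hℓ, -⟩ := two_mul_log_four_le (K := K) hβ hβ1
  set ℓ := Real.log (8 * ((K : ℝ) + 1) / β)
  set ζ := zetaClip L Δ lam
  have hζ : 0 ≤ ζ := zetaClip_nonneg L Δ lam
  have hσα : 0 < σ ^ α := by positivity
  rw [gamma₁, le_div_iff₀ (by positivity)] at h
  have h2 := pow_le_pow_left₀ (by positivity) h 2
  rw [Real.sq_sqrt hΔ.le] at h2
  refine le_trans ?_ h2
  have e1 : ((2 : ℝ) ^ (2 * α - 1) + 1) ^ ((1 : ℝ) / 2) = √((2 : ℝ) ^ (2 * α - 1) + 1) :=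
    (Real.sqrt_eq_rpow _).symm
  have e2 : (σ ^ (α / 2)) ^ 2 = σ ^ α := by
    rw [← Real.rpow_natCast, ← Real.rpow_mul hσ.le]; norm_num
  have e3 : (lam ^ (1 - α / 2)) ^ 2 = lam ^ (2 - α) := by
    rw [← Real.rpow_natCast, ← Real.rpow_mul hlam.le]; congr 1; push_cast; ring
  rw [e1]
  simp only [mul_pow, Real.sq_sqrt hL.le, e2, e3]
  rw [Real.sq_sqrt (by positivity), Real.sq_sqrt (by positivity)]
  have e4 : σ ^ α * (1 + ζ ^ α / σ ^ α) = σ ^ α + ζ ^ α := by field_simp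
  -- With `a = 2 ^ (α - 1)` this is `2a ≤ 2a² + 1`.
  have e5 : (2 : ℝ) * 2 ^ (α - 1) ≤ 2 ^ (2 * α - 1) + 1 := by
    rw [two_rpow_two_mul_sub_one]
    nlinarith [sq_nonneg ((2 : ℝ) ^ (α - 1) - 1), sq_nonneg ((2 : ℝ) ^ (α - 1))]
  calc _ = 2646 * γ ^ 2 * L * ((K : ℝ) + 1) * ℓ * lam ^ (2 - α) * (σ ^ α + ζ ^ α) *
        (2 * 2 ^ (α - 1)) := by ring
    _ ≤ 2646 * γ ^ 2 * L * ((K : ℝ) + 1) * ℓ * lam ^ (2 - α) * (σ ^ α + ζ ^ α) *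
        (2 ^ (2 * α - 1) + 1) := by gcongr
    _ = _ := by rw [← e4]; ring

lemma gamma₂_bound {K : ℕ} {L Δ lam σ α γ : ℝ} (hL : 0 < L) (hσ : 0 < σ)
    (hlam : 0 < lam) (hγ0 : 0 ≤ γ) (h : γ ≤ gamma₂ K L Δ lam σ α) :
    14 * (γ * √L * ((K : ℝ) + 1)) * (zetaClip L Δ lam +
      2 ^ (α - 1) * (σ ^ α + zetaClip L Δ lam ^ α) * (lam / 2) ^ (1 - α)) ≤ √Δ := by
  set ζ := zetaClip L Δ lam
  have hζ : 0 ≤ ζ := zetaClip_nonneg L Δ lam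
  have hσα : 0 < σ ^ α := by positivity
  set T := (2 : ℝ) ^ (2 * α - 1) * (σ ^ α + ζ ^ α) with hT
  have hT0 : 0 < T := by positivity
  set p := lam ^ (α - 1) with hp
  have hp0 : 0 < p := by positivity
  rw [gamma₂, le_div_iff₀ (by positivity)] at h
  refine le_of_mul_le_mul_right (le_trans ?_ h) hp0
  rw [mul_assoc _ (2 ^ (2 * α - 1)) (σ ^ α + ζ ^ α), ← hT]
  have e1 : (lam / 2) ^ (1 - α) * p = 2 ^ (α - 1) := by
    rw [hp, Real.div_rpow hlam.le (by norm_num), show 1 - α = -(α - 1) by ring,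
      Real.rpow_neg hlam.le, Real.rpow_neg (by norm_num)]
    field_simp
  calc _ = 14 * (γ * √L * ((K : ℝ) + 1)) *
        (ζ * p + 2 ^ (α - 1) * (σ ^ α + ζ ^ α) * ((lam / 2) ^ (1 - α) * p)) := by ring
    _ = 14 * (γ * √L * ((K : ℝ) + 1)) * (T * (1 / 2 + p * ζ / T)) := by
        rw [e1]; field_simp; rw [hT, two_rpow_two_mul_sub_one]; ring
    -- Only two of the four terms in the bracket of `gamma₂` are needed.
    _ ≤ 14 * (γ * √L * ((K : ℝ) + 1)) * (T * (ζ / lam + 1 / 2 + p * ζ / T +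
          (1 + ζ ^ α / σ ^ α) ^ (-1 / α))) := by
        have h1 : 0 ≤ (1 + ζ ^ α / σ ^ α) ^ (-1 / α) := by positivity
        have h2 : 0 ≤ ζ / lam := by positivity
        exact mul_le_mul_of_nonneg_left (mul_le_mul_of_nonneg_left (by linarith) hT0.le)
          (by positivity)
    _ = _ := by ring

lemma gamma₃_bound {d K : ℕ} {L Δ σω β γ : ℝ} (hL : 0 < L) (hΔ : 0 < Δ) (hσω : 0 ≤ σω)
    (hβ : 0 < β) (hβ1 : β ≤ 1) (hγ0 : 0 ≤ γ)
    (h : σω ≠ 0 → d ≠ 0 → γ ≤ gamma₃ d K L Δ σω β) :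
    784 * (γ ^ 2 * L * σω ^ 2 * d * ((K : ℝ) + 1)) * Real.log (8 * ((K : ℝ) + 1) / β) ≤ Δ := by
  obtain ⟨hℓ, hℓ4⟩ := two_mul_log_four_le (K := K) hβ hβ1
  rcases hσω.eq_or_lt with rfl | hσω
  · simpa using hΔ.le
  rcases Nat.eq_zero_or_pos d with rfl | hd
  · simpa using hΔ.le
  have h := h hσω.ne' hd.ne'
  have hd' : (0 : ℝ) < d := by exact_mod_cast hd
  have hφ0 : 0 ≤ phiConf K β := Real.sqrt_nonneg _
  have hφ : phiConf K β ^ 2 = 3 * Real.log (4 * ((K : ℝ) + 1) / β) :=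
    Real.sq_sqrt (by linarith)
  rw [gamma₃, le_div_iff₀ (by positivity)] at h
  have h2 := pow_le_pow_left₀ (by positivity) h 2
  rw [Real.sq_sqrt hΔ.le] at h2
  refine le_trans ?_ h2
  have e1 : √2 + √2 * phiConf K β = √2 * (1 + phiConf K β) := by ring
  rw [e1]
  simp only [mul_pow, Real.sq_sqrt hL.le, Real.sq_sqrt (zero_le_two : (0 : ℝ) ≤ 2)]
  rw [Real.sq_sqrt (by positivity)]
  calc _ = 392 * γ ^ 2 * L * σω ^ 2 * (d * ((K : ℝ) + 1)) *
        (2 * Real.log (8 * ((K : ℝ) + 1) / β)) := by ring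
    _ ≤ 392 * γ ^ 2 * L * σω ^ 2 * (d * ((K : ℝ) + 1)) * (1 + phiConf K β) ^ 2 := by
        gcongr
        nlinarith
    _ = _ := by ring

lemma gamma₅_bound {K : ℕ} {L Δ lam β γ : ℝ} (hL : 0 < L) (hlam : 0 < lam)
    (hβ : 0 < β) (hβ1 : β ≤ 1) (h : γ ≤ gamma₅ K L Δ lam β) :
    28 * (γ * lam * √L) * Real.log (8 * ((K : ℝ) + 1) / β) ≤ √Δ := by
  obtain ⟨hℓ, -⟩ := two_mul_log_four_le (K := K) hβ hβ1
  rw [gamma₅, le_div_iff₀ (by positivity)] at h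
  linarith

lemma gamma₆_bound {d K : ℕ} {L Δ σω β γ : ℝ} (hL : 0 < L) (hΔ : 0 < Δ) (hσω : 0 ≤ σω)
    (hβ : 0 < β) (hβ1 : β ≤ 1) (hγ0 : 0 ≤ γ) (h : σω ≠ 0 → γ ≤ gamma₆ d K L Δ σω β) :
    7 * (γ ^ 2 * L * σω ^ 2) *
      (((K : ℝ) + 1) * d + 4 / 3 * Real.log (8 * ((K : ℝ) + 1) / β)) ≤ Δ := by
  obtain ⟨hℓ, hℓ4⟩ := two_mul_log_four_le (K := K) hβ hβ1
  rcases hσω.eq_or_lt with rfl | hσω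
  · simpa using hΔ.le
  have h := h hσω.ne'
  have hx : 0 < Real.log (4 * ((K : ℝ) + 1) / β) := by linarith
  rw [gamma₆, le_div_iff₀ (by positivity)] at h
  have h2 := pow_le_pow_left₀ (by positivity) h 2
  rw [Real.sq_sqrt hΔ.le] at h2
  refine le_trans ?_ h2
  simp only [mul_pow, Real.sq_sqrt hL.le]
  rw [Real.sq_sqrt (by positivity)]
  have : 0 ≤ √(((K : ℝ) + 1) * d * Real.log (4 * ((K : ℝ) + 1) / β)) := Real.sqrt_nonneg _
  calc _ ≤ 7 * (γ ^ 2 * L * σω ^ 2) * (((K : ℝ) + 1) * d +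
        2 * √(((K : ℝ) + 1) * d * Real.log (4 * ((K : ℝ) + 1) / β)) +
        2 * Real.log (4 * ((K : ℝ) + 1) / β)) := by
        gcongr ?_ * ?_
        linarith
    _ = _ := by ring

/-- The exponents collected over all iterations fit into `ℓ`; here `G` bounds the gradient, `B` the
bias and `V` the second moment of the clipping error, and the log-mgf has parameter `2 ℓ / Δ`. -/
lemma exponent_budget {N ℓ L Δ γ lam σω d G B V : ℝ} (hN : 1 ≤ N) (hℓ : 2 ≤ ℓ) (hL : 0 < L)
    (hΔ : 0 < Δ) (hγ : 0 < γ) (hlam : 0 < lam) (hd : 0 ≤ d) (hG : 0 ≤ G)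
    (hGL : G ≤ 2 * (√L * √Δ)) (hGd : G ^ 2 ≤ d * G ^ 2) (hB : 0 ≤ B) (hV : 0 ≤ V)
    (h1 : 588 * (γ ^ 2 * L * N * ℓ) * V ≤ Δ) (h2 : 14 * (γ * √L * N) * B ≤ √Δ)
    (h3 : 784 * (γ ^ 2 * L * σω ^ 2 * d * N) * ℓ ≤ Δ) (h5 : 28 * (γ * lam * √L) * ℓ ≤ √Δ)
    (h6 : 7 * (γ ^ 2 * L * σω ^ 2) * (N * d + 4 / 3 * ℓ) ≤ Δ) :
    (2 * ℓ / Δ * γ * G) * (3 / 2 * lam) +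
        (2 * ℓ / Δ * (2 * L * γ ^ 2)) * (3 / 2 * lam) ^ 2 ≤ 1 ∧
      2 * (2 * ℓ / Δ * (L * γ ^ 2) * σω ^ 2) ≤ 3 / 7 ∧
      (2 * ℓ / Δ * γ * G) * B + (2 * ℓ / Δ * (2 * L * γ ^ 2) + (2 * ℓ / Δ * γ * G +
          2 * ℓ / Δ * (2 * L * γ ^ 2) * (3 / 2 * lam)) ^ 2) * V +
        (d * (7 / 8 * (2 * (2 * ℓ / Δ * (L * γ ^ 2) * σω ^ 2))) +
          7 / 8 * (σω ^ 2 * (2 * ℓ / Δ * γ * G) ^ 2)) ≤ ℓ / N := by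
  have hN0 : 0 < N := by linarith
  set A := √L with hA
  set E := √Δ with hE
  have hA0 : 0 < A := Real.sqrt_pos.2 hL
  have hE0 : 0 < E := Real.sqrt_pos.2 hΔ
  have hLA : L = A ^ 2 := (Real.sq_sqrt hL.le).symm
  have hΔE : Δ = E ^ 2 := (Real.sq_sqrt hΔ.le).symm
  clear_value A E
  subst hLA hΔE
  -- The scale-free step size `γ √(L/Δ)`, in which all the constraints become bounds by `1`.
  set r := γ * A / E with hr
  have hr0 : 0 < r := by positivity
  have k1 : 588 * (r ^ 2 * N * ℓ) * V ≤ 1 := by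
    have : 588 * (r ^ 2 * N * ℓ) * V = 588 * (γ ^ 2 * A ^ 2 * N * ℓ) * V / E ^ 2 := by
      rw [hr]; field_simp
    rw [this, div_le_one (by positivity)]; exact h1
  have k2 : 14 * (r * N) * B ≤ 1 := by
    have : 14 * (r * N) * B = 14 * (γ * A * N) * B / E := by rw [hr]; field_simp
    rw [this, div_le_one hE0]; exact h2
  have k3 : 784 * (r ^ 2 * σω ^ 2 * d * N) * ℓ ≤ 1 := by
    have : 784 * (r ^ 2 * σω ^ 2 * d * N) * ℓ =
        784 * (γ ^ 2 * A ^ 2 * σω ^ 2 * d * N) * ℓ / E ^ 2 := by rw [hr]; field_simp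
    rw [this, div_le_one (by positivity)]; exact h3
  have k5 : 28 * (r * lam) * ℓ ≤ 1 := by
    have : 28 * (r * lam) * ℓ = 28 * (γ * lam * A) * ℓ / E := by rw [hr]; field_simp
    rw [this, div_le_one hE0]; exact h5
  have k6 : 7 * (r ^ 2 * σω ^ 2) * (N * d + 4 / 3 * ℓ) ≤ 1 := by
    have : 7 * (r ^ 2 * σω ^ 2) * (N * d + 4 / 3 * ℓ) =
        7 * (γ ^ 2 * A ^ 2 * σω ^ 2) * (N * d + 4 / 3 * ℓ) / E ^ 2 := by rw [hr]; field_simp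
    rw [this, div_le_one (by positivity)]; exact h6
  have eq1 : 2 * ℓ / E ^ 2 * (2 * A ^ 2 * γ ^ 2) = 4 * ℓ * r ^ 2 := by
    rw [hr]; field_simp; ring
  have eq2 : 2 * (2 * ℓ / E ^ 2 * (A ^ 2 * γ ^ 2) * σω ^ 2) = 4 * ℓ * (r ^ 2 * σω ^ 2) := by
    rw [hr]; field_simp; ring
  set H := 2 * ℓ / E ^ 2 * γ * G with hH
  have hH0 : 0 ≤ H := by positivity
  have hHr : H ≤ 4 * ℓ * r := by
    calc H ≤ 2 * ℓ / E ^ 2 * γ * (2 * (A * E)) := by rw [hH]; gcongr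
      _ = 4 * ℓ * r := by rw [hr]; field_simp; ring
  have hHd : H ^ 2 ≤ d * (16 * ℓ ^ 2 * r ^ 2) := by
    calc H ^ 2 = (2 * ℓ / E ^ 2 * γ) ^ 2 * G ^ 2 := by rw [hH]; ring
      _ ≤ (2 * ℓ / E ^ 2 * γ) ^ 2 * (d * G ^ 2) := by gcongr
      _ = d * H ^ 2 := by rw [hH]; ring
      _ ≤ d * (4 * ℓ * r) ^ 2 := by gcongr
      _ = _ := by ring
  rw [eq1, eq2]
  -- `1/56` is `1/28` from `k5`, halved by `ℓ ≥ 2`.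
  have hrl : r * lam ≤ 1 / 56 := by nlinarith [mul_pos hr0 hlam]
  have hrl' : r * lam * ℓ ≤ 1 / 28 := by linarith
  refine ⟨?_, ?_, ?_⟩
  · have a1 : H * (3 / 2 * lam) ≤ 6 * (r * lam * ℓ) := by
      calc H * (3 / 2 * lam) ≤ 4 * ℓ * r * (3 / 2 * lam) := by gcongr
        _ = _ := by ring
    have a2 : 4 * ℓ * r ^ 2 * (3 / 2 * lam) ^ 2 = 9 * ((r * lam * ℓ) * (r * lam)) := by ring
    have a3 : (r * lam * ℓ) * (r * lam) ≤ 1 / 28 * (1 / 56) := by gcongr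
    rw [a2]; linarith
  · have hd0 : 0 ≤ r ^ 2 * σω ^ 2 * (N * d) := by positivity
    linarith
  · rw [le_div_iff₀ hN0]
    have b1 : H * B * N ≤ 2 / 7 * ℓ := by
      calc H * B * N ≤ 4 * ℓ * r * B * N := by gcongr
        _ = 2 / 7 * ℓ * (14 * (r * N) * B) := by ring
        _ ≤ 2 / 7 * ℓ * 1 := by gcongr
        _ = _ := by ring
    have b2 : 4 * ℓ * r ^ 2 * V * N ≤ 1 / 147 := by linarith
    have b3 : (H + 4 * ℓ * r ^ 2 * (3 / 2 * lam)) ^ 2 * V * N ≤ 18 / 588 * ℓ := by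
      have c1 : H + 4 * ℓ * r ^ 2 * (3 / 2 * lam) ≤ 4.2 * ℓ * r := by
        have : 4 * ℓ * r ^ 2 * (3 / 2 * lam) = 6 * (ℓ * r) * (r * lam) := by ring
        have : 6 * (ℓ * r) * (r * lam) ≤ 6 * (ℓ * r) * (1 / 56) := by gcongr
        have : 0 < ℓ * r := by positivity
        linarith
      calc (H + 4 * ℓ * r ^ 2 * (3 / 2 * lam)) ^ 2 * V * N ≤ (4.2 * ℓ * r) ^ 2 * V * N := by
            gcongr
        _ = 17.64 / 588 * ℓ * (588 * (r ^ 2 * N * ℓ) * V) := by ring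
        _ ≤ 17.64 / 588 * ℓ * 1 := by gcongr
        _ ≤ _ := by linarith
    have b4 : d * (7 / 8 * (4 * ℓ * (r ^ 2 * σω ^ 2))) * N ≤ 1 / 2 * ℓ := by
      have c1 : 7 * (r ^ 2 * σω ^ 2) * (N * d) ≤ 1 := by
        have : 0 ≤ r ^ 2 * σω ^ 2 * ℓ := by positivity
        linarith
      calc d * (7 / 8 * (4 * ℓ * (r ^ 2 * σω ^ 2))) * N
          = 1 / 2 * ℓ * (7 * (r ^ 2 * σω ^ 2) * (N * d)) := by ring
        _ ≤ 1 / 2 * ℓ * 1 := by gcongr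
        _ = _ := by ring
    have b5 : 7 / 8 * (σω ^ 2 * H ^ 2) * N ≤ 14 / 784 * ℓ := by
      calc 7 / 8 * (σω ^ 2 * H ^ 2) * N
          ≤ 7 / 8 * (σω ^ 2 * (d * (16 * ℓ ^ 2 * r ^ 2))) * N := by gcongr
        _ = 14 / 784 * ℓ * (784 * (r ^ 2 * σω ^ 2 * d * N) * ℓ) := by ring
        _ ≤ 14 / 784 * ℓ * 1 := by gcongr
        _ = _ := by ring
    -- The shares of `ℓ` are `2/7`, `1/294` (from `1/147` and `ℓ ≥ 2`), `18/588`, `1/2` and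
    -- `14/784`, about `0.84` in total.
    calc _ = H * B * N + 4 * ℓ * r ^ 2 * V * N +
          (H + 4 * ℓ * r ^ 2 * (3 / 2 * lam)) ^ 2 * V * N +
          d * (7 / 8 * (4 * ℓ * (r ^ 2 * σω ^ 2))) * N + 7 / 8 * (σω ^ 2 * H ^ 2) * N := by ring
      _ ≤ ℓ := by linarith

/-! ### One step: descent and exponential moment. -/

noncomputable section

/-- The part of one descent step that is due to the clipping error `e` and the noise `ω`. -/
def stepNoise {d : ℕ} (L γ : ℝ) (u e ω : Params d) : ℝ :=
  -(γ * ⟪u, e⟫) + 2 * L * γ ^ 2 * ‖e‖ ^ 2 + (-(γ * ⟪u, ω⟫) + L * γ ^ 2 * ‖ω‖ ^ 2)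

end

lemma closedBall_subset_sublevelNhd {d : ℕ} {f : Params d → ℝ} {fstar Δ L : ℝ} {x : Params d}
    (hx : f x ≤ fstar + 2 * Δ) :
    Metric.closedBall x (√Δ / (20 * √L)) ⊆ sublevelNhd f fstar Δ L := fun y hy =>
  ⟨x, hx, by rwa [← dist_eq_norm]⟩

lemma SmoothOn.clipped_step_le {d : ℕ} {f : Params d → ℝ} {fstar Δ L γ lam : ℝ}
    (hf : SmoothOn f (sublevelNhd f fstar Δ L) L) (hL : 0 < L) (hγ : 0 < γ) (hlam : 0 < lam)
    (hγL : γ * L ≤ 1 / 4) {x : Params d} (hx : f x ≤ fstar + 2 * Δ) (c ω : Params d)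
    (hstep : ‖γ • (c + ω)‖ ≤ √Δ / (20 * √L)) :
    f (x - γ • (c + ω)) ≤ f x - γ / 2 * (‖gradient f x‖ * min ‖gradient f x‖ (lam / 2)) +
      stepNoise L γ (gradient f x) (c - clip (gradient f x) (lam / 2)) ω := by
  have hr : 0 ≤ √Δ / (20 * √L) := by positivity
  have hseg : segment ℝ x (x - γ • (c + ω)) ⊆ sublevelNhd f fstar Δ L :=
    ((convex_closedBall x _).segment_subset (Metric.mem_closedBall_self hr)
      (by rwa [Metric.mem_closedBall, dist_eq_norm, sub_sub_cancel_left, norm_neg])).trans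
      (closedBall_subset_sublevelNhd hx)
  have h1 := hf.le_quadratic hseg
  have hl2 : 0 ≤ lam / 2 := by linarith
  set u := gradient f x with hu
  have hv := inner_clip (v := u) hl2
  have hvn := norm_clip (v := u) hl2
  set v := clip u (lam / 2) with hv'
  set m := min ‖u‖ (lam / 2) with hm
  have hm0 : 0 ≤ m := le_min (norm_nonneg _) hl2
  have hmu : m ≤ ‖u‖ := min_le_left _ _
  obtain ⟨e, rfl⟩ : ∃ e, c = v + e := ⟨c - v, by abel⟩
  rw [add_sub_cancel_left]
  rw [sub_sub_cancel_left, inner_neg_right, norm_neg, norm_smul, mul_pow, Real.norm_eq_abs, sq_abs,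
    real_inner_smul_right, inner_add_right, inner_add_right, hv] at h1
  -- The parallelogram law applied twice, dropping the differences. The `4 m²` term costs at most
  -- half of the descent because `γ L ≤ 1/4`.
  have h2 : ‖v + e + ω‖ ^ 2 ≤ 4 * m ^ 2 + 4 * ‖e‖ ^ 2 + 2 * ‖ω‖ ^ 2 := by
    have a1 := parallelogram_law_with_norm ℝ (v + e) ω
    have a2 := parallelogram_law_with_norm ℝ v e
    rw [hvn] at a2
    nlinarith [mul_self_nonneg ‖v + e - ω‖, mul_self_nonneg ‖v - e‖]
  have h3 : L / 2 * (γ ^ 2 * ‖v + e + ω‖ ^ 2) ≤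
      L / 2 * (γ ^ 2 * (4 * m ^ 2 + 4 * ‖e‖ ^ 2 + 2 * ‖ω‖ ^ 2)) := by gcongr
  have h4 : 2 * γ * (γ * L) * m ^ 2 ≤ 2 * γ * (1 / 4) * (‖u‖ * m) := by
    have : m ^ 2 ≤ ‖u‖ * m := by nlinarith
    gcongr
  rw [stepNoise]
  linarith

/-- Squared, this follows from `(1 - y)(1 + 7y/4) ≥ 1`, which for `y ≥ 0` means exactly `y ≤ 3/7`.
-/
lemma inv_sqrt_one_sub_le {y : ℝ} (hy0 : 0 ≤ y) (hy : y ≤ 3 / 7) :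
    (√(1 - y))⁻¹ ≤ Real.exp (7 / 8 * y) := by
  have h1 : (1 - y)⁻¹ ≤ Real.exp (7 / 8 * y) ^ 2 := by
    rw [← Real.exp_nat_mul]
    refine le_trans ?_ (Real.add_one_le_exp _)
    rw [inv_le_iff_one_le_mul₀ (by linarith)]
    push_cast
    nlinarith
  rw [← Real.sqrt_inv]
  exact Real.sqrt_le_iff.2 ⟨(Real.exp_pos _).le, h1⟩

-- Sample and noise are independent, so the moment factors into a clipping part, bounded by the
-- Bernstein estimate, and an explicit Gaussian part; `exponent_budget` adds the exponents.
set_option maxHeartbeats 1000000 in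
lemma lintegral_exp_stepNoise_le {d K : ℕ} {Ξ : Type*} [MeasurableSpace Ξ] {D : Measure Ξ}
    [IsProbabilityMeasure D] {L Δ lam σ α σω β γ : ℝ} (hL : 0 < L) (hΔ : 0 < Δ) (hσ : 0 < σ)
    (hα : 1 < α) (hα2 : α ≤ 2) (hσω : 0 ≤ σω) (hlam : 0 < lam) (hβ : 0 < β) (hβ1 : β ≤ 1)
    (hγ : StepSizeOK d K L Δ lam σ α σω β γ) {h : Ξ → Params d} (hh : Measurable h)
    {u : Params d} (hu : ‖u‖ ≤ 2 * (√L * √Δ)) (hint : Integrable h D) (hhu : ∫ s, h s ∂D = u)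
    (hint2 : Integrable (fun s => ‖h s - u‖ ^ α) D) (hmom : ∫ s, ‖h s - u‖ ^ α ∂D ≤ σ ^ α) :
    ∫⁻ z, ENNReal.ofReal (Real.exp (2 * Real.log (8 * ((K : ℝ) + 1) / β) / Δ *
        stepNoise L γ u (clip (h z.1) lam - clip u (lam / 2)) z.2)) ∂(D.prod (dpNoise d σω)) ≤
      ENNReal.ofReal (Real.exp (Real.log (8 * ((K : ℝ) + 1) / β) / ((K : ℝ) + 1))) := by
  have hγ0 := hγ.pos
  have hζ := zetaClip_nonneg L Δ lam
  have hℓ := (two_mul_log_four_le (K := K) hβ hβ1).1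
  have hu' : ‖u‖ ≤ lam / 2 + zetaClip L Δ lam := by
    have := le_max_right 0 (2 * √(L * Δ) - lam / 2)
    rw [Real.sqrt_mul hL.le] at this
    rw [zetaClip, Real.sqrt_mul hL.le]
    linarith
  have hB := norm_integral_clip_sub_le hlam hζ hα.le hu' hh hint hhu hint2 hmom
  have hV := integral_sq_norm_clip_sub_le hlam hζ hα.le hα2 hu' hint2 hmom
  have k1 := gamma₁_bound hL hΔ hσ hlam hβ hβ1 hγ0.le hγ.le₁
  have k2 := gamma₂_bound hL hσ hlam hγ0.le hγ.le₂
  have k3 := gamma₃_bound hL hΔ hσω hβ hβ1 hγ0.le hγ.le₃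
  have k5 := gamma₅_bound hL hlam hβ hβ1 hγ.le₅
  have k6 := gamma₆_bound hL hΔ hσω hβ hβ1 hγ0.le hγ.le₆
  -- For `d = 0` the bound `gamma₃` is void, but then `u = 0`.
  have hGd : ‖u‖ ^ 2 ≤ d * ‖u‖ ^ 2 := by
    rcases Nat.eq_zero_or_pos d with rfl | hd
    · simp [Subsingleton.elim u 0]
    · have : (1 : ℝ) ≤ d := by exact_mod_cast hd
      nlinarith [sq_nonneg ‖u‖]
  set ℓ := Real.log (8 * ((K : ℝ) + 1) / β)
  set B := zetaClip L Δ lam +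
    2 ^ (α - 1) * (σ ^ α + zetaClip L Δ lam ^ α) * (lam / 2) ^ (1 - α)
  set V := 9 * lam ^ (2 - α) * (2 ^ (α - 1) * (σ ^ α + zetaClip L Δ lam ^ α))
  obtain ⟨e1, e2, e3⟩ := exponent_budget (N := (K : ℝ) + 1) (by simp) hℓ hL hΔ hγ0 hlam
    d.cast_nonneg (norm_nonneg u) hu hGd ((norm_nonneg _).trans hB)
    (le_trans (integral_nonneg fun s => sq_nonneg _) hV) k1 k2 k3 k5 k6
  set s := 2 * ℓ / Δ with hs
  have hs0 : 0 ≤ s := by positivity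
  set b : Params d := (s * γ) • u with hb
  have hbn : ‖b‖ = s * γ * ‖u‖ := by
    rw [hb, norm_smul, Real.norm_eq_abs, abs_of_nonneg (by positivity)]
  set q := s * (2 * L * γ ^ 2) with hq
  set θ : Ξ → Params d := fun t => clip (h t) lam - clip u (lam / 2) with hθ
  have hθm : Measurable θ := ((measurable_clip lam).comp hh).sub_const _
  set a := s * (L * γ ^ 2) with ha
  have hpt : ∀ z : Ξ × Params d, ENNReal.ofReal (Real.exp (s * stepNoise L γ u (θ z.1) z.2)) =
      ENNReal.ofReal (Real.exp (-⟪b, θ z.1⟫ + q * ‖θ z.1‖ ^ 2)) *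
        ENNReal.ofReal (Real.exp (⟪-b, z.2⟫ + a * ‖z.2‖ ^ 2)) := by
    intro z
    rw [← ENNReal.ofReal_mul (Real.exp_pos _).le, ← Real.exp_add, stepNoise, hb, inner_neg_left,
      real_inner_smul_left, real_inner_smul_left, hq, ha]
    congr 2
    ring
  have hexp := integral_exp_neg_inner_add_sq_le (D := D) hθm
    (fun t => norm_clip_sub_clip_half_le hlam.le) (by positivity : 0 ≤ q) b (by rw [hbn]; exact e1)
  have hy0 : 0 ≤ 2 * (a * σω ^ 2) := by positivity
  have hfst : ∫⁻ t, ENNReal.ofReal (Real.exp (-⟪b, θ t⟫ + q * ‖θ t‖ ^ 2)) ∂D ≤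
      ENNReal.ofReal (Real.exp (s * γ * ‖u‖ * B + (q + (s * γ * ‖u‖ + q * (3 / 2 * lam)) ^ 2) *
        V)) := by
    rw [← ofReal_integral_eq_lintegral_ofReal _ (ae_of_all _ fun t => (Real.exp_pos _).le)]
    · refine ENNReal.ofReal_le_ofReal (hexp.trans (Real.exp_le_exp.2 ?_))
      rw [hbn]
      gcongr
    · refine Integrable.of_bound (by fun_prop) (Real.exp (‖b‖ * (3 / 2 * lam) +
        q * (3 / 2 * lam) ^ 2)) (ae_of_all _ fun t => ?_)
      rw [Real.norm_eq_abs, Real.abs_exp]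
      have hn : ‖θ t‖ ≤ 3 / 2 * lam := norm_clip_sub_clip_half_le hlam.le
      have h1 : -⟪b, θ t⟫ ≤ ‖b‖ * ‖θ t‖ := by
        linarith [(abs_le.1 (abs_real_inner_le_norm b (θ t))).1]
      have h2 : ‖b‖ * ‖θ t‖ ≤ ‖b‖ * (3 / 2 * lam) := by gcongr
      have h3 : q * ‖θ t‖ ^ 2 ≤ q * (3 / 2 * lam) ^ 2 := by gcongr
      exact Real.exp_le_exp.2 (by linarith)
  have hsnd : ∫⁻ ω, ENNReal.ofReal (Real.exp (⟪-b, ω⟫ + a * ‖ω‖ ^ 2)) ∂(dpNoise d σω) ≤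
      ENNReal.ofReal (Real.exp (d * (7 / 8 * (2 * (a * σω ^ 2))) +
        7 / 8 * (σω ^ 2 * (s * γ * ‖u‖) ^ 2))) := by
    rw [lintegral_dpNoise_exp hσω (-b) (by linarith), norm_neg, hbn]
    refine ENNReal.ofReal_le_ofReal ?_
    rw [Real.exp_add, Real.exp_nat_mul]
    have hi := inv_sqrt_one_sub_le hy0 e2
    gcongr
    rw [div_le_iff₀ (by linarith)]
    have hE : 0 ≤ σω ^ 2 * (s * γ * ‖u‖) ^ 2 := by positivity
    have h1 : 1 ≤ 7 / 8 * (2 * (1 - 2 * (a * σω ^ 2))) := by linarith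
    calc _ ≤ σω ^ 2 * (s * γ * ‖u‖) ^ 2 * (7 / 8 * (2 * (1 - 2 * (a * σω ^ 2)))) :=
          le_mul_of_one_le_right hE h1
      _ = _ := by ring
  refine (lintegral_congr hpt).trans_le ?_
  rw [lintegral_prod_mul (f := fun t => ENNReal.ofReal (Real.exp (-⟪b, θ t⟫ + q * ‖θ t‖ ^ 2)))
    (g := fun ω => ENNReal.ofReal (Real.exp (⟪-b, ω⟫ + a * ‖ω‖ ^ 2)))
    (by fun_prop) (by fun_prop)]
  refine (mul_le_mul' hfst hsnd).trans ?_
  rw [← ENNReal.ofReal_mul (Real.exp_pos _).le, ← Real.exp_add]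
  exact ENNReal.ofReal_le_ofReal (Real.exp_le_exp.2 e3)

/-- A sum of increments that is frozen once it exceeds `Δ` and stays below `Δ` controls the whole
trajectory. -/
lemma stopped_descent {E : Type*} {f H : E → ℝ} {fstar Δ : ℝ} {K : ℕ} {x : ℕ → E} {Y S : ℕ → ℝ}
    (hstep : ∀ t < K, f (x t) ≤ fstar + 2 * Δ → f (x (t + 1)) ≤ f (x t) - H (x t) + Y t)
    (hH : ∀ y, 0 ≤ H y) (hx0 : f (x 0) ≤ fstar + Δ) (hS0 : S 0 = 0)
    (hS : ∀ t, f (x t) ≤ fstar + 2 * Δ → S t ≤ Δ → S (t + 1) = S t + Y t)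
    (hSstop : ∀ t, Δ < S t → S (t + 1) = S t) (hSK : S K ≤ Δ) :
    ∀ t ≤ K, S t ≤ Δ ∧ f (x t) + ∑ i ∈ Finset.range t, H (x i) ≤ fstar + Δ + S t := by
  -- Freezing replaces a maximal inequality: an earlier excess would persist to time `K`.
  have hle : ∀ t ≤ K, S t ≤ Δ := by
    intro t ht
    by_contra! hlt
    have : ∀ n, S (t + n) = S t := by
      intro n
      induction n with
      | zero => rfl
      | succ n ih => rw [← add_assoc, hSstop _ (by rwa [ih]), ih]
    have h := this (K - t)
    rw [Nat.add_sub_cancel' ht] at h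
    linarith
  intro t ht
  refine ⟨hle t ht, ?_⟩
  induction t with
  | zero => simpa [hS0] using hx0
  | succ t ih =>
    have h1 := ih (Nat.le_of_succ_le ht)
    have h2 := hle t (Nat.le_of_succ_le ht)
    have h3 : 0 ≤ ∑ i ∈ Finset.range t, H (x i) := Finset.sum_nonneg fun i _ => hH _
    have h4 : f (x t) ≤ fstar + 2 * Δ := by linarith
    have h5 := hstep t ht h4
    rw [Finset.sum_range_succ, hS t h4 h2]
    linarith

lemma inf'_sq_le_of_sum_mul_min_le {K : ℕ} {G : ℕ → ℝ} {γ Δ lam : ℝ} (hγ : 0 < γ) (hΔ : 0 < Δ)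
    (hlam : 0 < lam) (hG : ∀ t, 0 ≤ G t)
    (hsum : ∑ t ∈ Finset.range (K + 1), γ / 2 * (G t * min (G t) (lam / 2)) ≤ 2 * Δ) :
    (Finset.range (K + 1)).inf' Finset.nonempty_range_add_one (fun t => G t ^ 2) ≤
      8 * Δ / (γ * ((K : ℝ) + 1)) + 128 * Δ ^ 2 / (lam ^ 2 * γ ^ 2 * ((K : ℝ) + 1) ^ 2) := by
  obtain ⟨i, -, hi⟩ := Finset.exists_mem_eq_inf' (s := Finset.range (K + 1))
    Finset.nonempty_range_add_one (fun t => G t ^ 2)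
  -- `G ↦ G min(G, lam/2)` is monotone on `G ≥ 0`, so the smallest gradient norm also has the
  -- smallest summand.
  have hmin : ∀ t ∈ Finset.range (K + 1), G i ≤ G t := fun t ht => by
    have h := Finset.inf'_le (fun t => G t ^ 2) ht
    rw [hi] at h
    exact (sq_le_sq₀ (hG i) (hG t)).1 h
  rw [hi]
  set N : ℝ := (K : ℝ) + 1 with hN
  have hN0 : 0 < N := by positivity
  have h1 : N * (γ / 2 * (G i * min (G i) (lam / 2))) ≤ 2 * Δ := by
    refine le_trans ?_ hsum
    have h := Finset.card_nsmul_le_sum (Finset.range (K + 1))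
      (fun t => γ / 2 * (G t * min (G t) (lam / 2))) (γ / 2 * (G i * min (G i) (lam / 2)))
      fun t ht => by
        have := hmin t ht
        have := hG i
        have := hG t
        have : 0 ≤ min (G i) (lam / 2) := le_min (hG i) (by linarith)
        gcongr
    simpa [hN] using h
  have p1 : 0 ≤ 128 * Δ ^ 2 / (lam ^ 2 * γ ^ 2 * N ^ 2) := by positivity
  have p2 : 0 ≤ 8 * Δ / (γ * N) := by positivity
  rcases le_total (G i) (lam / 2) with h | h
  · rw [min_eq_left h] at h1
    have : G i ^ 2 ≤ 8 * Δ / (γ * N) := by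
      rw [le_div_iff₀ (by positivity)]; linarith
    linarith
  · rw [min_eq_right h] at h1
    have h2 : G i * (lam * γ * N) ≤ 8 * Δ := by linarith
    have : G i ^ 2 ≤ 128 * Δ ^ 2 / (lam ^ 2 * γ ^ 2 * N ^ 2) := by
      rw [le_div_iff₀ (by positivity)]
      have h3 := pow_le_pow_left₀ (mul_nonneg (hG i) (by positivity)) h2 2
      linarith [sq_nonneg Δ, mul_pow (G i) (lam * γ * N) 2, mul_pow (lam * γ) N 2,
        mul_pow lam γ 2, mul_pow 8 Δ 2]
    linarith

/-! ### The stopped noise sum and its tail. -/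

noncomputable section

/-- One iteration of DP-Clipped-SGD together with the running sum of its noise increments; the sum
is only updated in the region `A`. -/
def noiseTrackedStep {d : ℕ} {Ξ : Type*} (g : Params d → Ξ → Params d) (u : Params d → Params d)
    (A : Set (Params d × ℝ)) [DecidablePred (· ∈ A)] (L γ lam : ℝ) (p : Params d × ℝ)
    (z : Ξ × Params d) : Params d × ℝ :=
  (p.1 - γ • (clip (g p.1 z.1) lam + z.2),
    if p ∈ A then p.2 + stepNoise L γ (u p.1) (clip (g p.1 z.1) lam - clip (u p.1) (lam / 2)) z.2
    else p.2)

/-- The trajectory of `noiseTrackedStep` along given samples, started at `(x₀, 0)`. -/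
def noiseTracked {d : ℕ} {Ξ : Type*} (g : Params d → Ξ → Params d) (u : Params d → Params d)
    (A : Set (Params d × ℝ)) [DecidablePred (· ∈ A)] (L γ lam : ℝ) (x₀ : Params d)
    (s : ℕ → Ξ) (w : ℕ → Params d) : ℕ → Params d × ℝ
  | 0 => (x₀, 0)
  | t + 1 => noiseTrackedStep g u A L γ lam (noiseTracked g u A L γ lam x₀ s w t) (s t, w t)

end

section

variable {d : ℕ} {Ξ : Type*} {g : Params d → Ξ → Params d} {u : Params d → Params d}
  {A : Set (Params d × ℝ)} [DecidablePred (· ∈ A)] {L γ lam : ℝ} {x₀ : Params d}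

lemma noiseTracked_fst (s : ℕ → Ξ) (w : ℕ → Params d) (t : ℕ) :
    (noiseTracked g u A L γ lam x₀ s w t).1 = dpClippedSGD g x₀ γ lam s w t := by
  induction t with
  | zero => rfl
  | succ t ih => simp only [noiseTracked, noiseTrackedStep, dpClippedSGD, ih]

lemma measurable_noiseTrackedStep [MeasurableSpace Ξ] (hg : Measurable (Function.uncurry g))
    (hu : Measurable u) (hA : MeasurableSet A) :
    Measurable (Function.uncurry (noiseTrackedStep g u A L γ lam)) := by
  have h1 : Measurable fun q : (Params d × ℝ) × Ξ × Params d => clip (g q.1.1 q.2.1) lam :=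
    (measurable_clip lam).comp (hg.comp (measurable_fst.fst.prodMk measurable_snd.fst))
  have h2 : Measurable fun q : (Params d × ℝ) × Ξ × Params d => u q.1.1 :=
    hu.comp measurable_fst.fst
  have h3 : Measurable fun q : (Params d × ℝ) × Ξ × Params d => clip (u q.1.1) (lam / 2) :=
    (measurable_clip _).comp h2
  unfold Function.uncurry noiseTrackedStep stepNoise
  refine Measurable.prodMk (by fun_prop) (Measurable.ite (measurable_fst hA) ?_ (by fun_prop))
  fun_prop

end

lemma IsDPSampling.measure_noise_norm_gt_le {d : ℕ} {Ω Ξ : Type*} [MeasurableSpace Ω]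
    [MeasurableSpace Ξ] {P : Measure Ω} {D : Measure Ξ} [IsProbabilityMeasure D] {σω : ℝ}
    {ξ : ℕ → Ω → Ξ} {w : ℕ → Ω → Params d} (h : IsDPSampling P D σω ξ w) (hσω : 0 ≤ σω) {x : ℝ}
    (hx : 0 ≤ x) (t : ℕ) :
    P {a | σω * (√(d : ℝ) + √(2 * x)) < ‖w t a‖} ≤ ENNReal.ofReal (Real.exp (-x)) := by
  have hw : P.map (w t) = dpNoise d σω := by
    have h1 := congrArg (fun ν => ν.map Prod.snd) (h.law t)
    simp only [Measure.map_snd_prod, measure_univ, one_smul] at h1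
    rw [← h1, Measure.map_map measurable_snd
      ((h.measurable_sample t).prodMk (h.measurable_noise t))]
    rfl
  refine le_trans (le_of_eq ?_) (dpNoise_norm_tail d hσω hx)
  rw [← hw, Measure.map_apply (h.measurable_noise t)
    (measurableSet_lt measurable_const measurable_norm)]
  rfl

/-- `exp(s S)` gains at most a factor `exp c` per step, both inside `A` by `hmgf` and outside, where
the sum is frozen and `1 ≤ exp c`; Markov's inequality at time `K` concludes. -/
lemma measure_noiseTracked_gt_le {d : ℕ} {Ω Ξ : Type*} [MeasurableSpace Ω] [MeasurableSpace Ξ]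
    {P : Measure Ω} [IsProbabilityMeasure P] {D : Measure Ξ} [IsProbabilityMeasure D]
    {g : Params d → Ξ → Params d} {u : Params d → Params d} {A : Set (Params d × ℝ)}
    [DecidablePred (· ∈ A)] {L γ lam σω s c Δ : ℝ} {x₀ : Params d}
    {ξ : ℕ → Ω → Ξ} {w : ℕ → Ω → Params d} (hsamp : IsDPSampling P D σω ξ w)
    (hg : Measurable (Function.uncurry g)) (hu : Measurable u) (hA : MeasurableSet A)
    (hs : 0 ≤ s) (hc : 0 ≤ c)
    (hmgf : ∀ p ∈ A, ∫⁻ z, ENNReal.ofReal (Real.exp (s * stepNoise L γ (u p.1)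
      (clip (g p.1 z.1) lam - clip (u p.1) (lam / 2)) z.2)) ∂(D.prod (dpNoise d σω)) ≤
        ENNReal.ofReal (Real.exp c)) (K : ℕ) :
    P {a | Δ < (noiseTracked g u A L γ lam x₀ (fun k => ξ k a) (fun k => w k a) K).2} ≤
      ENNReal.ofReal (Real.exp (K * c - s * Δ)) := by
  set X : ℕ → Ω → Params d × ℝ := fun t a =>
    noiseTracked g u A L γ lam x₀ (fun k => ξ k a) (fun k => w k a) t with hX
  set V : Params d × ℝ → ENNReal := fun p => ENNReal.ofReal (Real.exp (s * p.2)) with hV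
  have hVm : Measurable V := by fun_prop
  have hΦ := measurable_noiseTrackedStep (L := L) (γ := γ) (lam := lam) hg hu hA
  have hζ : ∀ t, Measurable fun a => (ξ t a, w t a) := fun t =>
    (hsamp.measurable_sample t).prodMk (hsamp.measurable_noise t)
  have hstep : ∀ p, ∫⁻ z, V (noiseTrackedStep g u A L γ lam p z) ∂(D.prod (dpNoise d σω)) ≤
      ENNReal.ofReal (Real.exp c) * V p := by
    intro p
    by_cases hp : p ∈ A
    · simp only [hV, noiseTrackedStep, if_pos hp, mul_add, Real.exp_add,
        ENNReal.ofReal_mul (Real.exp_pos _).le]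
      rw [lintegral_const_mul' _ _ ENNReal.ofReal_ne_top, mul_comm]
      gcongr
      exact hmgf p hp
    · simp only [hV, noiseTrackedStep, if_neg hp, lintegral_const, measure_univ, mul_one]
      refine le_mul_of_one_le_left' ?_
      rw [ENNReal.one_le_ofReal]
      exact Real.one_le_exp hc
  have hchain := lintegral_markovChain_le (X := X) (x₀ := (x₀, (0 : ℝ))) hζ hsamp.law hsamp.indep
    hΦ (fun a => rfl) (fun t a => rfl) hVm hstep K
  have hXm : Measurable (X K) := by
    have : ∀ t, Measurable (X t) := by
      intro t
      induction t with
      | zero => exact measurable_const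
      | succ t ih => exact hΦ.comp (ih.prodMk (hζ t))
    exact this K
  have hmarkov := meas_ge_le_lintegral_div (μ := P) (f := fun a => V (X K a))
    (hVm.comp hXm).aemeasurable (ε := ENNReal.ofReal (Real.exp (s * Δ)))
    (by simp [Real.exp_pos]) ENNReal.ofReal_ne_top
  refine (measure_mono fun a ha => ?_).trans (hmarkov.trans ?_)
  · have ha : Δ < (X K a).2 := ha
    exact ENNReal.ofReal_le_ofReal (Real.exp_le_exp.2 (mul_le_mul_of_nonneg_left ha.le hs))
  · rw [Real.exp_sub, ENNReal.ofReal_div_of_pos (Real.exp_pos _), Real.exp_nat_mul,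
      ENNReal.ofReal_pow (Real.exp_pos _).le]
    gcongr
    simpa [hV] using hchain

/-! ### Assembly of the theorem. -/

theorem theorem2 {d : ℕ} {Ω Ξ : Type*} [MeasurableSpace Ω] [MeasurableSpace Ξ]
    (P : Measure Ω) [IsProbabilityMeasure P] (D : Measure Ξ) [IsProbabilityMeasure D]
    (f : Params d → ℝ) (g : Params d → Ξ → Params d) (x₀ : Params d)
    (fstar Δ L σ α σω lam β γ : ℝ) (K : ℕ)
    (hL : 0 < L) (hσ : 0 < σ) (hα : 1 < α) (hα2 : α ≤ 2) (hσω : 0 ≤ σω) (hlam : 0 < lam)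
    (hβ : 0 < β) (hβ1 : β ≤ 1)
    (hg : Measurable (Function.uncurry g))
    (hΔ : f x₀ - fstar ≤ Δ)
    (hinf : HasInfOn f (sublevelNhd f fstar Δ L) fstar)
    (hsmooth : SmoothOn f (sublevelNhd f fstar Δ L) L)
    (horacle : OracleOn f (sublevelNhd f fstar Δ L) g D σ α)
    (hγ : StepSizeOK d K L Δ lam σ α σω β γ)
    (ξ : ℕ → Ω → Ξ) (w : ℕ → Ω → Params d) (hsamp : IsDPSampling P D σω ξ w) :
    P {a | (∀ t ≤ K, DifferentiableAt ℝ f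
            (dpClippedSGD g x₀ γ lam (fun k => ξ k a) (fun k => w k a) t)) ∧
          (Finset.range (K + 1)).inf' Finset.nonempty_range_add_one
            (fun t => ‖gradient f
              (dpClippedSGD g x₀ γ lam (fun k => ξ k a) (fun k => w k a) t)‖ ^ 2) ≤
            8 * Δ / (γ * ((K : ℝ) + 1)) +
              128 * Δ ^ 2 / (lam ^ 2 * γ ^ 2 * ((K : ℝ) + 1) ^ 2)}ᶜ ≤ ENNReal.ofReal β := by
  classical
  have hγ0 := hγ.pos
  obtain ⟨hℓ, -⟩ := two_mul_log_four_le (K := K) hβ hβ1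
  have hN0 : (0 : ℝ) < (K : ℝ) + 1 := by positivity
  -- Positivity of `Δ` is implicit in the step-size condition: otherwise `√Δ = 0` and `gamma₅`
  -- vanishes.
  have hΔ0 : 0 < Δ := by
    by_contra! hneg
    have := hγ.le₅
    rw [gamma₅, Real.sqrt_eq_zero_of_nonpos hneg, zero_div] at this
    linarith
  have hγL : γ * L ≤ 1 / 4 := by
    have := hγ.le_smooth
    rw [le_div_iff₀ (by positivity)] at this
    linarith
  set x := Real.log (((K : ℝ) + 1) / β) with hx
  have hx0 : 0 ≤ x := Real.log_nonneg (by rw [one_le_div hβ]; linarith [K.cast_nonneg (α := ℝ)])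
  set ℓ := Real.log (8 * ((K : ℝ) + 1) / β) with hℓdef
  set R := σω * (√(d : ℝ) + √(2 * x)) with hR
  have hR0 : 0 ≤ R := by positivity
  have hγ4 : γ * (lam + R) ≤ √Δ / (20 * √L) := by
    have := hγ.le₄
    rw [gamma₄, ← hx, ← hR, le_div_iff₀ (by positivity)] at this
    rw [le_div_iff₀ (by positivity)]
    linarith
  set S : Set (Params d) := {y | f y ≤ fstar + 2 * Δ} with hS
  have hSclosed : IsClosed S := isClosed_sublevel hL hΔ0 hsmooth
  have hSQ : S ⊆ sublevelNhd f fstar Δ L := fun y hy => mem_sublevelNhd hy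
  -- The gradient is only known to be continuous near `S`; cutting it off on the closed set `S`
  -- gives a globally measurable map, as the Markov chain requires.
  set u : Params d → Params d := S.indicator (gradient f) with hu
  have hum : Measurable u := by
    rw [hu, ← Set.piecewise_eq_indicator]
    exact ((continuousOn_gradient hL hsmooth).mono hSQ).measurable_piecewise
      continuousOn_const hSclosed.measurableSet
  have hGL : ∀ y ∈ S, ‖gradient f y‖ ≤ 2 * (√L * √Δ) := by
    intro y hy
    have h1 := sq_norm_gradient_le hL hΔ0 hinf hsmooth hy
    have h2 : f y - fstar ≤ 2 * Δ := by
      have : f y ≤ fstar + 2 * Δ := hy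
      linarith
    refine (sq_le_sq₀ (norm_nonneg _) (by positivity)).1 (h1.trans ?_)
    rw [mul_pow, mul_pow, Real.sq_sqrt hL.le, Real.sq_sqrt hΔ0.le]
    nlinarith
  set A : Set (Params d × ℝ) := {p | p.1 ∈ S ∧ p.2 ≤ Δ} with hA
  have hAm : MeasurableSet A :=
    (measurable_fst hSclosed.measurableSet).inter (measurableSet_le measurable_snd measurable_const)
  have hmgf : ∀ p ∈ A, ∫⁻ z, ENNReal.ofReal (Real.exp (2 * ℓ / Δ * stepNoise L γ (u p.1)
      (clip (g p.1 z.1) lam - clip (u p.1) (lam / 2)) z.2)) ∂(D.prod (dpNoise d σω)) ≤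
        ENNReal.ofReal (Real.exp (ℓ / ((K : ℝ) + 1))) := by
    intro p hp
    have hup : u p.1 = gradient f p.1 := Set.indicator_of_mem hp.1 _
    obtain ⟨⟨h1, h2⟩, h3, h4⟩ := horacle p.1 (hSQ hp.1)
    rw [hup]
    exact lintegral_exp_stepNoise_le hL hΔ0 hσ hα hα2 hσω hlam hβ hβ1 hγ
      (hg.comp measurable_prodMk_left) (hGL _ hp.1) h1 h2 h3 h4
  have hsum := measure_noiseTracked_gt_le (Δ := Δ) (x₀ := x₀) hsamp hg hum hAm
    (by positivity) (by positivity) hmgf K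
  have hsub : {a | (∀ t ≤ K, DifferentiableAt ℝ f
            (dpClippedSGD g x₀ γ lam (fun k => ξ k a) (fun k => w k a) t)) ∧
          (Finset.range (K + 1)).inf' Finset.nonempty_range_add_one
            (fun t => ‖gradient f
              (dpClippedSGD g x₀ γ lam (fun k => ξ k a) (fun k => w k a) t)‖ ^ 2) ≤
            8 * Δ / (γ * ((K : ℝ) + 1)) +
              128 * Δ ^ 2 / (lam ^ 2 * γ ^ 2 * ((K : ℝ) + 1) ^ 2)}ᶜ ⊆
      (⋃ t ∈ Finset.range K, {a | R < ‖w t a‖}) ∪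
      {a | Δ < (noiseTracked g u A L γ lam x₀ (fun k => ξ k a) (fun k => w k a) K).2} := by
    rw [Set.compl_subset_comm]
    intro a ha
    simp only [Set.mem_compl_iff, Set.mem_union, Set.mem_iUnion, Finset.mem_range, not_or,
      not_exists, Set.mem_ofPred_eq, not_lt] at ha
    obtain ⟨hw, hSK⟩ := ha
    set X := fun t => dpClippedSGD g x₀ γ lam (fun k => ξ k a) (fun k => w k a) t with hX
    set T := noiseTracked g u A L γ lam x₀ (fun k => ξ k a) (fun k => w k a) with hT
    have hTX : ∀ t, (T t).1 = X t := noiseTracked_fst _ _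
    set H : Params d → ℝ := fun y =>
      γ / 2 * (‖gradient f y‖ * min ‖gradient f y‖ (lam / 2)) with hH
    have hH0 : ∀ y, 0 ≤ H y := fun y => by
      have : 0 ≤ min ‖gradient f y‖ (lam / 2) := le_min (norm_nonneg _) (by linarith)
      positivity
    have hmain := stopped_descent (f := f) (H := H) (fstar := fstar) (Δ := Δ) (K := K) (x := X)
      (Y := fun t => stepNoise L γ (u (X t))
        (clip (g (X t) (ξ t a)) lam - clip (u (X t)) (lam / 2)) (w t a))
      (S := fun t => (T t).2)
      (by
        intro t ht hXt
        have huX : u (X t) = gradient f (X t) := Set.indicator_of_mem (s := S) hXt _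
        rw [huX]
        refine hsmooth.clipped_step_le hL hγ0 hlam hγL hXt _ _ (le_trans ?_ hγ4)
        rw [norm_smul, Real.norm_eq_abs, abs_of_pos hγ0]
        have h1 : ‖clip (g (X t) (ξ t a)) lam‖ ≤ lam := by
          rw [norm_clip hlam.le]; exact min_le_right _ _
        have h2 := norm_add_le (clip (g (X t) (ξ t a)) lam) (w t a)
        have h3 := hw t ht
        gcongr
        linarith)
      hH0 (by change f x₀ ≤ _; linarith) rfl
      (by
        intro t h1 h2
        have : T t ∈ A := ⟨by rw [hTX]; exact h1, h2⟩
        change (noiseTrackedStep g u A L γ lam (T t) (ξ t a, w t a)).2 = _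
        simp only [noiseTrackedStep, if_pos this, hTX])
      (by
        intro t h1
        have : T t ∉ A := fun h => absurd h.2 (not_le.2 h1)
        change (noiseTrackedStep g u A L γ lam (T t) (ξ t a, w t a)).2 = _
        simp only [noiseTrackedStep, if_neg this])
      hSK
    have hXS : ∀ t ≤ K, X t ∈ S := fun t ht => by
      obtain ⟨h1, h2⟩ := hmain t ht
      have : 0 ≤ ∑ i ∈ Finset.range t, H (X i) := Finset.sum_nonneg fun i _ => hH0 _
      change f (X t) ≤ _
      linarith
    refine ⟨fun t ht => hsmooth.1 _ (hSQ (hXS t ht)), ?_⟩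
    refine inf'_sq_le_of_sum_mul_min_le (G := fun t => ‖gradient f (X t)‖) hγ0 hΔ0 hlam
      (fun t => norm_nonneg _) ?_
    change ∑ t ∈ Finset.range (K + 1), H (X t) ≤ 2 * Δ
    obtain ⟨h1, h2⟩ := hmain K le_rfl
    -- The last gradient term is paid for by the remaining gap, not by a further step, so only the
    -- first `K` noise vectors must be controlled.
    have h3 : H (X K) ≤ f (X K) - fstar := by
      have h4 := sq_norm_gradient_le hL hΔ0 hinf hsmooth (hXS K le_rfl)
      set G := ‖gradient f (X K)‖ with hG
      have hG0 : 0 ≤ G := norm_nonneg _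
      have h5 : H (X K) ≤ γ / 2 * (G * G) := by
        simp only [hH]
        gcongr
        exact min_le_left _ _
      have h6 := hinf.le hΔ0.le (X K)
      nlinarith [mul_le_mul_of_nonneg_left h4 hγ0.le, mul_le_mul_of_nonneg_right hγL
        (sub_nonneg.2 h6)]
    rw [Finset.sum_range_succ]
    linarith
  refine (measure_mono hsub).trans ((measure_union_le _ _).trans ?_)
  have hexpx : Real.exp (-x) = β / ((K : ℝ) + 1) := by
    rw [hx, Real.exp_neg, Real.exp_log (by positivity), inv_div]
  have hexpl : Real.exp (-ℓ) = β / (8 * ((K : ℝ) + 1)) := by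
    rw [hℓdef, Real.exp_neg, Real.exp_log (by positivity), inv_div]
  have b1 : P (⋃ t ∈ Finset.range K, {a | R < ‖w t a‖}) ≤
      ENNReal.ofReal (K * (β / ((K : ℝ) + 1))) := by
    refine (measure_biUnion_finset_le _ _).trans ?_
    refine (Finset.sum_le_sum fun t _ =>
      hsamp.measure_noise_norm_gt_le hσω hx0 t).trans_eq ?_
    rw [Finset.sum_const, Finset.card_range, nsmul_eq_mul, hexpx,
      ENNReal.ofReal_mul K.cast_nonneg, ENNReal.ofReal_natCast]
  have b2 : Real.exp (K * (ℓ / ((K : ℝ) + 1)) - 2 * ℓ / Δ * Δ) ≤ β / (8 * ((K : ℝ) + 1)) := by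
    rw [← hexpl]
    refine Real.exp_le_exp.2 ?_
    have h1 : K * (ℓ / ((K : ℝ) + 1)) ≤ ℓ := by
      rw [mul_div_assoc', div_le_iff₀ hN0]; nlinarith
    rw [div_mul_cancel₀ _ hΔ0.ne']
    linarith
  calc _ ≤ ENNReal.ofReal (K * (β / ((K : ℝ) + 1))) +
        ENNReal.ofReal (β / (8 * ((K : ℝ) + 1))) :=
        add_le_add b1 (hsum.trans (ENNReal.ofReal_le_ofReal b2))
    _ = ENNReal.ofReal (K * (β / ((K : ℝ) + 1)) + β / (8 * ((K : ℝ) + 1))) :=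
        (ENNReal.ofReal_add (by positivity) (by positivity)).symm
    _ ≤ ENNReal.ofReal β := by
        refine ENNReal.ofReal_le_ofReal ?_
        -- `K` noise tails and one tail of the stopped sum fit: `K + 1/8 ≤ K + 1`.
        have h1 : K * (β / ((K : ℝ) + 1)) + β / (8 * ((K : ℝ) + 1)) =
            β * ((K + 1 / 8) / ((K : ℝ) + 1)) := by field_simp
        rw [h1]
        refine mul_le_of_le_one_right hβ.le ((div_le_one hN0).2 (by linarith))
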